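/- Let $n\ge 1$. A Morse function on $(\mathbb C^n,0)$ is a germ $f$ of a holomorphic function with $f(0)=0$ having a nondegenerate critical point at $0$; $q_f$ denotes its quadratic part. A Morse foliation $\mathcal F$ on $(\mathbb C^n,0)$ is the germ of the partition into level sets ("leaves") of a Morse function $f$, called a first integral of $\mathcal F$. A pair $(\mathcal F,\mathcal G)$ of Morse foliations is $\mathscr F$-generic if it has first integrals $f,g$ such that, in suitable linear coordinates, $q_f(x)=\sum_i x_i^2$ and $q_g(x)=\sum_i\lambda_i x_i^2$ with $\lambda_i\ne\lambda_j$ for $i\ne j$. For first integrals $f,g$ of $\mathcal F,\mathcal G$, the tangency locus $\mathrm{Tang}(\mathcal F,\mathcal G)$ is the germ of the set where all $\partial_{x_i}f\,\partial_{x_j}g-\partial_{x_j}f\,\partial_{x_i}g$ vanish; for an $\mathscr F$-generic pair there are exactly $n$ germs of smooth curves at $0$ contained in it, the tangency curves, and a numbering of them is written $T_1,\dots,T_n$. Given a numbering, let $i_f^n$ (resp. $i_g^n$) be the involution of $T_n$ sending a point to the other point of $T_n$ on the same leaf of $\mathcal F$ (resp. $\mathcal G$). For $j<n$ let $\varphi^{\mathcal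 F}_{nj}$ (resp. $\varphi^{\mathcal G}_{nj}$) be a holonomy transport from $T_n$ to $T_j$, i.e. a germ of analytic diffeomorphism $(T_n,0)\to(T_j,0)$ sending each point to a point on the same leaf of $\mathcal F$ (resp. $\mathcal G$); there are two determinations of each and one is chosen. Put $\varphi_{njn}=(\varphi^{\mathcal G}_{nj})^{-1}\circ\varphi^{\mathcal F}_{nj}\in\mathrm{Diff}(T_n)$ and $\mathrm{Inv}(\mathcal F,\mathcal G)=\big((i_f^n,i_g^n),(\varphi_{njn})_{j<n}\big)$. Two invariants $\mathrm{Inv}_0$, $\mathrm{Inv}_1$, on curves $T_n^0$, $T_n^1$, are equivalent if there is $\psi\in\mathrm{Diff}(T_n^0,T_n^1)$ with $\psi^{-1}\circ\mathrm{Inv}_1\circ\psi=\mathrm{Inv}_0$, componentwise. Theorem. Let $(\mathcal F_0,\mathcal G_0)$ and $(\mathcal F_1,\mathcal G_1)$ be two $\mathscr F$-generic pairs of Morse foliations on $(\mathbb C^n,0)$. Suppose that their tangency curves $T^i_j$ ($j=1,\dots,n$, $i=0,1$) can be numbered, and the determinations of the holonomy transports chosen, so that their invariants are equivalent. Then $(\mathcal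 F_0,\mathcal G_0)$ and $(\mathcal F_1,\mathcal G_1)$ are analytically conjugated: there is a germ of analytic diffeomorphism of $(\mathbb C^n,0)$ mapping the leaves of $\mathcal F_0$ to those of $\mathcal F_1$ and the leaves of $\mathcal G_0$ to those of $\mathcal G_1$. -/

import Mathlib

open Filter Topology

namespace MorsePairs

/-- The space `ℂⁿ`. -/
abbrev Cn (n : ℕ) : Type := Fin n → ℂ

/-- `φ` represents an element of `Diff(E, 0)`: a germ at `0` of an analytic diffeomorphism fixing
`0` (by the inverse function theorem it suffices that the derivative at `0` is invertible).
Used for `E = ℂⁿ` and for `E = ℂ`. -/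
def IsDiffGerm {E : Type*} [NormedAddCommGroup E] [NormedSpace ℂ E] (φ : E → E) : Prop :=
  AnalyticAt ℂ φ 0 ∧ φ 0 = 0 ∧ (fderiv ℂ φ 0).IsInvertible

/-! ### Morse functions -/

/-- The Hessian of `f` at `0`, evaluated at `(v, w)`. -/
noncomputable def hessian {n : ℕ} (f : Cn n → ℂ) (v w : Cn n) : ℂ :=
  fderiv ℂ (fderiv ℂ f) 0 v w

/-- The quadratic part `q_f` of `f` at `0`. -/
noncomputable def quadPart {n : ℕ} (f : Cn n → ℂ) (v : Cn n) : ℂ :=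
  hessian f v v / 2

/-- `f` represents a Morse function on `(ℂⁿ, 0)`: a germ of a holomorphic function vanishing at `0`
and having a nondegenerate critical point at `0`. -/
structure IsMorse {n : ℕ} (f : Cn n → ℂ) : Prop where
  analyticAt : AnalyticAt ℂ f 0
  map_zero : f 0 = 0
  critical : fderiv ℂ f 0 = 0
  nondegenerate : ∀ v, (∀ w, hessian f v w = 0) → v = 0

/-- An `R`-generic pair of Morse functions: in suitable linear coordinates the quadratic parts are
`∑ xᵢ²` and `∑ μᵢ xᵢ²` with pairwise distinct `μᵢ`. -/
def RGeneric {n : ℕ} (f g : Cn n → ℂ) : Prop :=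
  IsMorse f ∧ IsMorse g ∧ ∃ (A : Cn n ≃ₗ[ℂ] Cn n) (μ : Fin n → ℂ), Function.Injective μ ∧
    (∀ x, quadPart f (A x) = ∑ i, x i ^ 2) ∧ (∀ x, quadPart g (A x) = ∑ i, μ i * x i ^ 2)

/-- The tangency locus of `f` and `g`: the common zeros of the functions
`∂ᵢf ∂ⱼg - ∂ⱼf ∂ᵢg`. -/
def tang {n : ℕ} (f g : Cn n → ℂ) : Set (Cn n) :=
  {x | ∀ i j : Fin n,
    fderiv ℂ f x (Pi.single i 1) * fderiv ℂ g x (Pi.single j 1)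
      - fderiv ℂ f x (Pi.single j 1) * fderiv ℂ g x (Pi.single i 1) = 0}

/-! ### Morse foliations -/

/-- `f` is a Morse first integral of the partition of a neighbourhood of `0` given by the relation
`r`: near `0`, the classes of `r` are the level sets of `f`. -/
def IsMorseFirstIntegral {n : ℕ} (r : Cn n → Cn n → Prop) (f : Cn n → ℂ) : Prop :=
  IsMorse f ∧ ∀ᶠ p : Cn n × Cn n in 𝓝 0, (r p.1 p.2 ↔ f p.1 = f p.2)

/-- A (representative of a) Morse foliation on `(ℂⁿ, 0)`: the partition of a neighbourhood of `0`
into the level sets of some Morse function. Only the germ of the relation `sameLeaf` at `(0, 0)`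
is meaningful, and all notions below depend only on that germ. -/
structure MorseFoliation (n : ℕ) where
  sameLeaf : Cn n → Cn n → Prop
  exists_firstIntegral : ∃ f, IsMorseFirstIntegral sameLeaf f

/-- `f` is a Morse first integral of the foliation `F`. -/
def MorseFoliation.HasFirstIntegral {n : ℕ} (F : MorseFoliation n) (f : Cn n → ℂ) : Prop :=
  IsMorseFirstIntegral F.sameLeaf f

/-- An `F`-generic pair of Morse foliations: it has an `R`-generic pair of first integrals. -/
def FGeneric {n : ℕ} (F G : MorseFoliation n) : Prop :=
  ∃ f g, F.HasFirstIntegral f ∧ G.HasFirstIntegral g ∧ RGeneric f g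

/-- The pairs `(F₀, G₀)` and `(F₁, G₁)` are analytically conjugated: one germ of analytic
diffeomorphism of `(ℂⁿ, 0)` maps the leaves of `F₀` to those of `F₁` and the leaves of `G₀` to
those of `G₁`. -/
def AnalyticallyConjugated {n : ℕ} (F₀ G₀ F₁ G₁ : MorseFoliation n) : Prop :=
  ∃ φ : Cn n → Cn n, IsDiffGerm φ ∧
    (∀ᶠ p : Cn n × Cn n in 𝓝 0, (F₀.sameLeaf p.1 p.2 ↔ F₁.sameLeaf (φ p.1) (φ p.2))) ∧
    (∀ᶠ p : Cn n × Cn n in 𝓝 0, (G₀.sameLeaf p.1 p.2 ↔ G₁.sameLeaf (φ p.1) (φ p.2)))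

/-! ### Tangency curves -/

/-- A germ at `0` of a smooth holomorphic curve in `ℂⁿ`, given by a regular parametrization
`(ℂ, 0) → (ℂⁿ, 0)`. Through the parametrizations, germs of diffeomorphisms between two
such curves are the elements of `Diff(ℂ, 0)`. -/
structure SmoothCurve (n : ℕ) where
  param : ℂ → Cn n
  analyticAt : AnalyticAt ℂ param 0
  map_zero : param 0 = 0
  regular : deriv param 0 ≠ 0

/-- Two parametrizations describe the same germ of curve: they differ by a change of parameter. -/
def SmoothCurve.SameGerm {n : ℕ} (C D : SmoothCurve n) : Prop :=
  ∃ h : ℂ → ℂ, IsDiffGerm h ∧ ∀ᶠ t in 𝓝 0, C.param t = D.param (h t)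

/-- `C` is a tangency curve of `(F, G)`: a smooth curve contained, as a germ, in the tangency locus
`Tang(F, G) = Tang(f, g)` of first integrals `f`, `g` (this germ does not depend on `f`, `g`). -/
def IsTangencyCurve {n : ℕ} (F G : MorseFoliation n) (C : SmoothCurve n) : Prop :=
  ∀ f g, F.HasFirstIntegral f → G.HasFirstIntegral g → ∀ᶠ t in 𝓝 0, C.param t ∈ tang f g

/-- `T` numbers the tangency curves of `(F, G)`: it is a bijection from the `n` indices to the
germs of tangency curves. -/
def NumbersTangencyCurves {n : ℕ} (F G : MorseFoliation n) (T : Fin n → SmoothCurve n) : Prop :=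
  (∀ j, IsTangencyCurve F G (T j)) ∧
  (∀ i j, (T i).SameGerm (T j) → i = j) ∧
  (∀ C, IsTangencyCurve F G C → ∃ j, C.SameGerm (T j))

/-! ### The invariant -/

/-- `i ∈ Diff(C)` is the involution of `C` defined by `F`: it sends a point of `C` to the other
point of `C` on the same leaf. -/
def IsLeafInvolution {n : ℕ} (F : MorseFoliation n) (C : SmoothCurve n) (i : ℂ → ℂ) : Prop :=
  IsDiffGerm i ∧ (∀ᶠ t in 𝓝 0, F.sameLeaf (C.param t) (C.param (i t))) ∧
    (∀ᶠ t in 𝓝[≠] 0, i t ≠ t)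

/-- `h ∈ Diff(C, D)` is a (determination of the) holonomy transport from `C` to `D` following the
leaves of `F`. -/
def IsHolonomy {n : ℕ} (F : MorseFoliation n) (C D : SmoothCurve n) (h : ℂ → ℂ) : Prop :=
  IsDiffGerm h ∧ ∀ᶠ t in 𝓝 0, F.sameLeaf (C.param t) (D.param (h t))

/-- The shape of the data `((i_f, i_g), (φ_{njn})_{j < n})` for `n = m + 1`; the maps are
representatives of germs in `Diff(T_n)`, read in the parameter of `T_n`. -/
structure InvData (m : ℕ) where
  invF : ℂ → ℂ
  invG : ℂ → ℂ
  trans : Fin m → ℂ → ℂ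

/-- `I` is the invariant `Inv(F, G)` for the numbering `T` of the tangency curves and some choice of
the determinations of the holonomy transports. The curve `T_n` is `T (Fin.last m)`, the curves
`T_j`, `j < n`, are the `T j.castSucc`. The last clause says
`φ_{njn} = (φ^G_{nj})⁻¹ ∘ φ^F_{nj}` in `Diff(T_n)`. -/
def IsInvariant {m : ℕ} (F G : MorseFoliation (m + 1)) (T : Fin (m + 1) → SmoothCurve (m + 1))
    (I : InvData m) : Prop :=
  IsLeafInvolution F (T (Fin.last m)) I.invF ∧
  IsLeafInvolution G (T (Fin.last m)) I.invG ∧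
  ∀ j : Fin m, ∃ hF hG : ℂ → ℂ,
    IsHolonomy F (T (Fin.last m)) (T j.castSucc) hF ∧
    IsHolonomy G (T (Fin.last m)) (T j.castSucc) hG ∧
    IsDiffGerm (I.trans j) ∧ ∀ᶠ t in 𝓝 0, hG (I.trans j t) = hF t

/-- Two invariants are equivalent: there is `ψ ∈ Diff(T_n⁰, T_n¹)` with
`ψ⁻¹ ∘ I₁ ∘ ψ = I₀`, componentwise and as germs. -/
def InvData.Equivalent {m : ℕ} (I₀ I₁ : InvData m) : Prop :=
  ∃ ψ : ℂ → ℂ, IsDiffGerm ψ ∧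
    (∀ᶠ t in 𝓝 0, I₁.invF (ψ t) = ψ (I₀.invF t)) ∧
    (∀ᶠ t in 𝓝 0, I₁.invG (ψ t) = ψ (I₀.invG t)) ∧
    ∀ j, ∀ᶠ t in 𝓝 0, I₁.trans j (ψ t) = ψ (I₀.trans j t)

end MorsePairs

/-! Up to one change of coordinates, a generic pair of functions is determined by its restrictions
to the tangency curves. If `p k` parametrizes the `k`-th curve, there is a diffeomorphism `Φ` with f
= ∑ f(p_k(Φ_k)) and g = ∑ g(p_k(Φ_k)), the same `Φ` for both (`exists_normalForm`). Two pairs with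
equal restrictions therefore have equal normal forms and are conjugate (`exists_conjugacy`).

The invariant makes the restrictions equal. On T_n, a function with a nondegenerate critical point
is determined by its involution up to a diffeomorphism of the target (`exists_diffGerm_comp_eq`), so
first integrals of the two pairs can be matched through `ψ` on T_n. Each other curve is parametrized
by T_n through the holonomy of the first foliation. In this parameter f restricts to f on T_n, and g
restricts to g on T_n composed with φ_{njn} (`IsInvariant.exists_transport`). Conjugate invariants
thus give equal restrictions on every curve.

For the normal form, first move the curves to the coordinate axes. Tangency says that df and dg are
proportional along each axis, so one change of coordinates, `straighten`, makes both functions agree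
with the sums of their restrictions to first order along all axes. The two errors then lie in the
ideal generated by x_i² x_j² and x_i x_j x_l (`inGenIdeal_of_axes`). They are absorbed by a
displacement x ↦ x + d(x) whose unknown coefficients, two for each generator, solve two equations
per generator (`exists_diffGerm_of_inGenIdeal`). The determinant of the linear part is nonzero
because the eigenvalue ratios are distinct. The quadratic terms in d stay in the ideal, and at the
origin the system becomes constant after two iterations, so the implicit function theorem applies.

That the numbered curves can be moved to the axes rests on two facts: each tangency curve is tangent
to a common eigendirection of the quadratic parts (`exists_direction`), and only one such curve has
a given tangent (`exists_reparam_of_direction`). -/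

namespace MorsePairs

/-! ### Division of analytic germs by a coordinate -/

section Division

variable {E G F : Type*} [NormedAddCommGroup E] [NormedSpace ℂ E] [NormedAddCommGroup G]
  [NormedSpace ℂ G] [NormedAddCommGroup F] [NormedSpace ℂ F] [CompleteSpace F]

/-- Averaging an analytic function over a path of linear contractions gives an analytic function. -/
theorem analyticAt_intervalIntegral_comp {f : E → F} (hf : AnalyticAt ℂ f 0)
    {A : ℝ → G →L[ℂ] E} (hA : Continuous A) (hA1 : ∀ u ∈ Set.Icc (0 : ℝ) 1, ‖A u‖ ≤ 1) :
    AnalyticAt ℂ (fun z => ∫ u in (0 : ℝ)..1, f (A u z)) 0 := by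
  obtain ⟨p, r, hp⟩ := hf
  have hA1' : ∀ u ∈ Set.uIoc (0 : ℝ) 1, ‖A u‖ ≤ 1 := fun u hu => by
    rw [Set.uIoc_of_le zero_le_one] at hu
    exact hA1 u ⟨hu.1.le, hu.2⟩
  have hcont : ∀ n, Continuous fun u => (p n).compContinuousLinearMap (fun _ => A u) := fun n =>
    ((ContinuousMultilinearMap.compContinuousLinearMapContinuousMultilinear ℂ
      (fun _ : Fin n => G) (fun _ : Fin n => E) F).cont.comp
        (continuous_pi fun _ => hA)).clm_apply continuous_const
  have hnorm : ∀ n, ∀ u ∈ Set.uIoc (0 : ℝ) 1,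
      ‖(p n).compContinuousLinearMap (fun _ => A u)‖ ≤ ‖p n‖ := fun n u hu => by
    refine (ContinuousMultilinearMap.norm_compContinuousLinearMap_le _ _).trans ?_
    refine mul_le_of_le_one_right (norm_nonneg _) ?_
    exact Finset.prod_le_one (fun _ _ => norm_nonneg _) fun _ _ => hA1' u hu
  -- The average of the pulled-back series. Contractions do not increase the norms of the terms, so
  -- the radius does not shrink, and dominated convergence exchanges sum and integral.
  let q : FormalMultilinearSeries ℂ G F := fun n =>
    ∫ u in (0 : ℝ)..1, (p n).compContinuousLinearMap (fun _ => A u)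
  have hq : ∀ n, ‖q n‖ ≤ ‖p n‖ := fun n => by
    simpa using intervalIntegral.norm_integral_le_of_norm_le_const (hnorm n)
  refine ⟨q, r, ?_, hp.r_pos, fun {y} hy => ?_⟩
  · exact hp.r_le.trans (FormalMultilinearSeries.radius_le_of_le fun n => by simpa using hq n)
  · have happ : ∀ n, q n (fun _ => y) = ∫ u in (0 : ℝ)..1, p n (fun _ => A u y) := fun n => by
      have := (ContinuousMultilinearMap.apply ℂ (fun _ : Fin n => G) F
        (fun _ => y)).intervalIntegral_comp_comm
          ((hcont n).intervalIntegrable (μ := MeasureTheory.volume) 0 1)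
      simp only [q]
      rw [← ContinuousMultilinearMap.apply_apply (𝕜 := ℂ), ← this]
      rfl
    have hyr : ∀ u ∈ Set.uIoc (0 : ℝ) 1, A u y ∈ Metric.eball (0 : E) r := fun u hu => by
      rw [Metric.mem_eball, edist_zero_right] at hy ⊢
      refine lt_of_le_of_lt ?_ hy
      rw [← ofReal_norm, ← ofReal_norm]
      exact ENNReal.ofReal_le_ofReal (((A u).le_opNorm y).trans
        (mul_le_of_le_one_left (norm_nonneg _) (hA1' u hu)))
    simp only [zero_add, happ]
    have hy' : ‖y‖₊ < p.radius := by
      refine lt_of_lt_of_le ?_ hp.r_le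
      rwa [Metric.mem_eball, edist_zero_right] at hy
    refine intervalIntegral.hasSum_integral_of_dominated_convergence
      (fun n _ => ‖p n‖ * ‖y‖ ^ n) (fun n => ?_) (fun n => ?_) ?_ ?_ ?_
    · exact (((ContinuousMultilinearMap.apply ℂ (fun _ : Fin n => G) F
        (fun _ => y)).continuous.comp (hcont n))).aestronglyMeasurable
    · refine Eventually.of_forall fun u hu => ?_
      refine ((p n).le_opNorm _).trans ?_
      simp only [Finset.prod_const, Finset.card_univ, Fintype.card_fin]
      gcongr
      exact ((A u).le_opNorm y).trans (mul_le_of_le_one_left (norm_nonneg _) (hA1' u hu))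
    · refine Eventually.of_forall fun u _ => ?_
      simpa using p.summable_norm_mul_pow hy'
    · exact intervalIntegrable_const
    · refine Eventually.of_forall fun u hu => ?_
      simpa using hp.hasSum (hyr u hu)

theorem analyticAt_fderiv_apply {h : E → F} {x : E} (hh : AnalyticAt ℂ h x) (e : E) :
    AnalyticAt ℂ (fun z => fderiv ℂ h z e) x :=
  ((ContinuousLinearMap.apply ℂ F e).analyticAt _).comp hh.fderiv

/-- Division by a linear coordinate. -/
theorem exists_eq_add_mul {h : E × ℂ → ℂ} (hh : AnalyticAt ℂ h 0) :
    ∃ k : E × ℂ → ℂ, AnalyticAt ℂ k 0 ∧ ∀ᶠ z in 𝓝 0, h z = h (z.1, 0) + z.2 * k z := by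
  let e : E × ℂ := (0, 1)
  -- `A u` multiplies the last coordinate by `u`. The quotient is the average over `u` of the last
  -- partial derivative, by the fundamental theorem of calculus.
  let A : ℝ → E × ℂ →L[ℂ] E × ℂ := fun u =>
    (ContinuousLinearMap.inl ℂ E ℂ).comp (.fst ℂ E ℂ)
      + (u : ℂ) • (ContinuousLinearMap.inr ℂ E ℂ).comp (.snd ℂ E ℂ)
  have hA : ∀ u z, A u z = (z.1, u * z.2) := fun u z => by simp [A]
  have hAn : ∀ u ∈ Set.Icc (0 : ℝ) 1, ‖A u‖ ≤ 1 := fun u hu => by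
    refine ContinuousLinearMap.opNorm_le_bound _ zero_le_one fun z => ?_
    rw [hA, one_mul, Prod.norm_def, Prod.norm_def]
    refine max_le_max le_rfl ?_
    rw [norm_mul, Complex.norm_real, Real.norm_of_nonneg hu.1]
    exact mul_le_of_le_one_left (norm_nonneg _) hu.2
  have hd : AnalyticAt ℂ (fun z => fderiv ℂ h z e) 0 :=
    analyticAt_fderiv_apply hh e
  refine ⟨_, analyticAt_intervalIntegral_comp hd (A := A) (by fun_prop) hAn, ?_⟩
  obtain ⟨r, hr, hball⟩ := hh.exists_ball_analyticOnNhd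
  filter_upwards [Metric.ball_mem_nhds 0 hr] with z hz
  have hmem : ∀ u ∈ Set.Icc (0 : ℝ) 1, A u z ∈ Metric.ball (0 : E × ℂ) r := fun u hu => by
    rw [mem_ball_zero_iff] at hz ⊢
    exact (((A u).le_opNorm z).trans (mul_le_of_le_one_left (norm_nonneg _) (hAn u hu))).trans_lt hz
  have hderiv : ∀ u ∈ Set.uIcc (0 : ℝ) 1,
      HasDerivAt (fun u : ℝ => h (A u z)) (z.2 • fderiv ℂ h (A u z) e) u := fun u hu => by
    rw [Set.uIcc_of_le zero_le_one] at hu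
    have h1 : HasDerivAt (fun u : ℂ => ((z.1, u * z.2) : E × ℂ)) (z.2 • e) (u : ℂ) := by
      have := (hasDerivAt_const (u : ℂ) z.1).prodMk ((hasDerivAt_id (u : ℂ)).mul_const z.2)
      have he : z.2 • e = ((0 : E), 1 * z.2) := by simp [e]
      rw [he]
      exact this
    have h2 := (hball _ (hmem u hu)).differentiableAt.hasFDerivAt
    rw [hA] at h2
    have h3 := (h2.comp_hasDerivAt (u : ℂ) h1).comp_ofReal
    simp only [map_smul] at h3
    simp only [hA]; exact h3
  have hint := intervalIntegral.integral_eq_sub_of_hasDerivAt hderiv (by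
    refine ContinuousOn.intervalIntegrable fun u hu => ?_
    rw [Set.uIcc_of_le zero_le_one] at hu
    have : ContinuousAt (fun u : ℝ => A u z) u := by
      simp only [hA]; fun_prop
    have h2 : ContinuousAt (fun y => fderiv ℂ h y e) (A u z) :=
      (analyticAt_fderiv_apply (hball _ (hmem u hu)) e).continuousAt
    exact ((ContinuousAt.comp (f := fun u : ℝ => A u z) h2 this).const_smul z.2).continuousWithinAt)
  rw [intervalIntegral.integral_smul] at hint
  rw [← smul_eq_mul (a := z.2), hint]
  simp [hA]

end Division

/-! ### The ideal of germs vanishing to order two along all axes -/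

section Ideal

variable {n : ℕ}

attribute [fun_prop] analyticAt_fst analyticAt_snd

@[fun_prop]
theorem analyticAt_coord (i : Fin n) (x : Cn n) : AnalyticAt ℂ (fun x : Cn n => x i) x :=
  (ContinuousLinearMap.proj (R := ℂ) (φ := fun _ : Fin n => ℂ) i).analyticAt x

/-- Division by a coordinate function of `ℂⁿ`. -/
theorem exists_eq_update_add_mul {h : Cn n → ℂ} (hh : AnalyticAt ℂ h 0) (i : Fin n) :
    ∃ k : Cn n → ℂ, AnalyticAt ℂ k 0 ∧
      ∀ᶠ x in 𝓝 0, h x = h (Function.update x i 0) + x i * k x := by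
  have hup : ∀ (x : Cn n) (s : ℂ), Function.update x i s = x + (s - x i) • Pi.single i 1 := by
    intro x s
    ext j
    by_cases hj : j = i
    · subst hj; simp
    · simp [hj]
  -- The value placed in slot `i` is made an independent variable, so that division by the last
  -- factor applies; it is set back to `x i` afterwards.
  have h1 : AnalyticAt ℂ (fun z : Cn n × ℂ => h (Function.update z.1 i z.2)) 0 := by
    simp only [hup]
    have hg : AnalyticAt ℂ (fun z : Cn n × ℂ => z.1 + (z.2 - z.1 i) • Pi.single i (1 : ℂ)) 0 := by
      fun_prop
    exact hh.comp_of_eq hg (by simp)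
  obtain ⟨k, hk, hkeq⟩ := exists_eq_add_mul h1
  have hg : AnalyticAt ℂ (fun x : Cn n => (x, x i)) 0 := by fun_prop
  refine ⟨fun x => k (x, x i), hk.comp_of_eq hg rfl, ?_⟩
  filter_upwards [hg.continuousAt.tendsto.eventually hkeq] with x hx
  simpa using hx

/-- Telescoping division by the coordinate functions indexed by `U`. -/
theorem exists_eq_piecewise_add_sum {h : Cn n → ℂ} (hh : AnalyticAt ℂ h 0) (U : Finset (Fin n)) :
    ∃ k : Fin n → Cn n → ℂ, (∀ l, AnalyticAt ℂ (k l) 0) ∧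
      ∀ᶠ x in 𝓝 0, h x = h (U.piecewise 0 x) + ∑ l ∈ U, x l * k l x := by
  induction U using Finset.induction_on with
  | empty => exact ⟨fun _ _ => 0, fun _ => analyticAt_const, by simp⟩
  | insert i U hi ih =>
    obtain ⟨k, hk, hkeq⟩ := ih
    have hp : AnalyticAt ℂ (fun x : Cn n => U.piecewise (0 : Cn n) x) 0 := by
      rw [analyticAt_pi_iff]
      intro j
      by_cases hj : j ∈ U
      · simp only [hj, Finset.piecewise_eq_of_mem]; exact analyticAt_const
      · simp only [hj, not_false_eq_true, Finset.piecewise_eq_of_notMem]; fun_prop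
    have h1 : AnalyticAt ℂ (fun x : Cn n => h (U.piecewise 0 x)) 0 :=
      hh.comp_of_eq hp (by ext j; simp [Finset.piecewise])
    obtain ⟨k', hk', hkeq'⟩ := exists_eq_update_add_mul h1 i
    refine ⟨Function.update k i k', fun l => ?_, ?_⟩
    · by_cases hl : l = i
      · subst hl; simpa using hk'
      · simpa [hl] using hk l
    · filter_upwards [hkeq, hkeq'] with x h1 h2
      have h3 : U.piecewise (0 : Cn n) (Function.update x i 0) = (insert i U).piecewise 0 x := by
        ext j
        by_cases hj : j = i
        · subst hj; simp [hi]
        · by_cases hjU : j ∈ U <;> simp [hj, hjU]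
      rw [h1, h2, h3, Finset.sum_insert hi, add_assoc]
      congr 1
      simp only [Function.update_self]
      congr 1
      refine Finset.sum_congr rfl fun l hl => ?_
      rw [Function.update_of_ne (ne_of_mem_of_not_mem hl hi)]

/-- A continuous germ of one variable killed by the coordinate vanishes. -/
theorem eventually_eq_zero_of_mul {c : ℂ → ℂ} (hc : ContinuousAt c 0)
    (h : ∀ᶠ t in 𝓝 0, t * c t = 0) : ∀ᶠ t in 𝓝 0, c t = 0 := by
  have h1 : ∀ᶠ t in 𝓝[≠] (0 : ℂ), c t = 0 := by
    filter_upwards [h.filter_mono nhdsWithin_le_nhds, self_mem_nhdsWithin] with t ht ht0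
    exact (mul_eq_zero.1 ht).resolve_left ht0
  have h0 : c 0 = 0 := by
    refine tendsto_nhds_unique (hc.tendsto.mono_left (nhdsWithin_le_nhds (s := {0}ᶜ))) ?_
    exact tendsto_const_nhds.congr' (h1.mono fun t ht => ht.symm)
  rw [eventually_nhdsWithin_iff] at h1
  filter_upwards [h1] with t ht
  by_cases ht0 : t = 0
  · rw [ht0, h0]
  · exact ht ht0

theorem analyticAt_single (i : Fin n) (x : ℂ) :
    AnalyticAt ℂ (fun t : ℂ => (Pi.single i t : Cn n)) x :=
  (ContinuousLinearMap.single ℂ (fun _ : Fin n => ℂ) i).analyticAt x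

theorem eventually_single {p : Cn n → Prop} (h : ∀ᶠ x in 𝓝 0, p x) (i : Fin n) :
    ∀ᶠ t in 𝓝 (0 : ℂ), p (Pi.single i t) := by
  have := (analyticAt_single i (0 : ℂ)).continuousAt.tendsto
  rw [Pi.single_zero] at this
  exact this.eventually h

theorem eventually_coord_single {p : Cn n → Prop} {i : Fin n}
    (h : ∀ᶠ t in 𝓝 (0 : ℂ), p (Pi.single i t)) : ∀ᶠ x : Cn n in 𝓝 0, p (Pi.single i (x i)) :=
  ((continuous_apply i).tendsto (0 : Cn n)).eventually h

/-- Indices of the generators `xᵢ² xⱼ²` and `xᵢ xⱼ xₗ` (`i`, `j`, `l` distinct). -/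
abbrev GenIdx (n : ℕ) : Type :=
  {t : Fin n × Fin n × Option (Fin n) // t.1 ≠ t.2.1 ∧ ∀ l, t.2.2 = some l → l ≠ t.1 ∧ l ≠ t.2.1}

/-- The cofactor of `xᵢ xⱼ` in a generator. -/
def cofactor (t : GenIdx n) (x : Cn n) : ℂ :=
  match t.1.2.2 with
  | none => x t.1.1 * x t.1.2.1
  | some l => x l

/-- The generators `xᵢ² xⱼ²` and `xᵢ xⱼ xₗ`. -/
def gen (t : GenIdx n) (x : Cn n) : ℂ := x t.1.1 * x t.1.2.1 * cofactor t x

/-- The index of `xᵢ² xⱼ²`. -/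
def GenIdx.pair {i j : Fin n} (h : i ≠ j) : GenIdx n := ⟨(i, j, none), h, by simp⟩

/-- The index of `xᵢ xⱼ xₗ`. -/
def GenIdx.triple {i j l : Fin n} (h : i ≠ j) (hi : l ≠ i) (hj : l ≠ j) : GenIdx n :=
  ⟨(i, j, some l), h, by rintro l' ⟨⟩; exact ⟨hi, hj⟩⟩

theorem gen_pair {i j : Fin n} (h : i ≠ j) (x : Cn n) :
    gen (.pair h) x = x i * x j * (x i * x j) := rfl

theorem gen_triple {i j l : Fin n} (h : i ≠ j) (hi : l ≠ i) (hj : l ≠ j) (x : Cn n) :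
    gen (.triple h hi hj) x = x i * x j * x l := rfl

/-- `h` belongs to the ideal of analytic germs generated by the `gen t`. -/
def InGenIdeal (h : Cn n → ℂ) : Prop :=
  ∃ A : GenIdx n → Cn n → ℂ, (∀ t, AnalyticAt ℂ (A t) 0) ∧
    ∀ᶠ x in 𝓝 0, h x = ∑ t, gen t x * A t x

theorem InGenIdeal.gen_mul (t : GenIdx n) {a : Cn n → ℂ} (ha : AnalyticAt ℂ a 0) :
    InGenIdeal fun x => gen t x * a x := by
  refine ⟨fun u => if u = t then a else fun _ => 0, fun u => ?_, Eventually.of_forall fun x => ?_⟩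
  · by_cases h : u = t
    · simpa [h] using ha
    · simpa [h] using analyticAt_const
  · rw [Finset.sum_eq_single t] <;> simp +contextual

theorem InGenIdeal.zero : InGenIdeal (fun _ : Cn n => 0) :=
  ⟨fun _ _ => 0, fun _ => analyticAt_const, by simp⟩

theorem InGenIdeal.add {h k : Cn n → ℂ} (hh : InGenIdeal h) (hk : InGenIdeal k) :
    InGenIdeal fun x => h x + k x := by
  obtain ⟨A, hA, hAe⟩ := hh
  obtain ⟨B, hB, hBe⟩ := hk
  refine ⟨fun t x => A t x + B t x, fun t => (hA t).add (hB t), ?_⟩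
  filter_upwards [hAe, hBe] with x h1 h2
  rw [h1, h2, ← Finset.sum_add_distrib]
  exact Finset.sum_congr rfl fun t _ => by ring

theorem InGenIdeal.sum {ι : Type*} (s : Finset ι) {h : ι → Cn n → ℂ}
    (hh : ∀ i ∈ s, InGenIdeal (h i)) : InGenIdeal fun x => ∑ i ∈ s, h i x := by
  classical
  induction s using Finset.induction_on with
  | empty => simpa using InGenIdeal.zero
  | insert i s hi ih =>
    simp only [Finset.sum_insert hi]
    exact (hh i (by simp)).add (ih fun j hj => hh j (by simp [hj]))

theorem InGenIdeal.congr {h k : Cn n → ℂ} (hh : InGenIdeal h) (e : ∀ᶠ x in 𝓝 0, k x = h x) :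
    InGenIdeal k := by
  obtain ⟨A, hA, hAe⟩ := hh
  exact ⟨A, hA, by filter_upwards [hAe, e] with x h1 h2; rw [h2, h1]⟩

theorem piecewise_erase (i : Fin n) (x : Cn n) :
    (Finset.univ.erase i).piecewise (0 : Cn n) x = Pi.single i (x i) := by
  ext j
  by_cases hj : j = i
  · subst hj; simp
  · simp [hj, Finset.piecewise]

/-- A germ vanishing on the `i`-th axis is a combination of the other coordinates. -/
theorem exists_eq_sum_of_axis {h : Cn n → ℂ} (hh : AnalyticAt ℂ h 0) (i : Fin n)
    (h0 : ∀ᶠ t in 𝓝 (0 : ℂ), h (Pi.single i t) = 0) :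
    ∃ k : Fin n → Cn n → ℂ, (∀ l, AnalyticAt ℂ (k l) 0) ∧
      ∀ᶠ x in 𝓝 0, h x = ∑ l ∈ Finset.univ.erase i, x l * k l x := by
  obtain ⟨k, hk, he⟩ := exists_eq_piecewise_add_sum hh (Finset.univ.erase i)
  refine ⟨k, hk, ?_⟩
  filter_upwards [he, eventually_coord_single (p := fun x => h x = 0) h0] with x h1 h2
  rw [h1, piecewise_erase, h2, zero_add]

/-- A germ vanishing on two axes. -/
theorem exists_eq_of_two_axes {h : Cn n → ℂ} (hh : AnalyticAt ℂ h 0) {i j : Fin n} (hij : i ≠ j)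
    (hi : ∀ᶠ t in 𝓝 (0 : ℂ), h (Pi.single i t) = 0)
    (hj : ∀ᶠ t in 𝓝 (0 : ℂ), h (Pi.single j t) = 0) :
    ∃ (k : Cn n → ℂ) (k' : Fin n → Cn n → ℂ), AnalyticAt ℂ k 0 ∧ (∀ l, AnalyticAt ℂ (k' l) 0) ∧
      ∀ᶠ x in 𝓝 0, h x = x i * x j * k x + ∑ l ∈ {i, j}ᶜ, x l * k' l x := by
  obtain ⟨k', hk', he'⟩ := exists_eq_piecewise_add_sum hh {i, j}ᶜ
  -- `δ` is the restriction of `h` to the plane of `x i` and `x j`. It vanishes on both axes of this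
  -- plane, hence is divisible by `x i` and then by `x j`.
  set δ : Cn n → ℂ := fun x => h (Finset.piecewise {i, j}ᶜ 0 x) with hδ
  have hp : AnalyticAt ℂ (fun x : Cn n => Finset.piecewise {i, j}ᶜ (0 : Cn n) x) 0 := by
    rw [analyticAt_pi_iff]
    intro l
    by_cases hl : l ∈ ({i, j}ᶜ : Finset (Fin n))
    · simp only [hl, Finset.piecewise_eq_of_mem]; exact analyticAt_const
    · simp only [hl, not_false_eq_true, Finset.piecewise_eq_of_notMem]; fun_prop
  have hδa : AnalyticAt ℂ δ 0 := hh.comp_of_eq hp (by ext l; simp [Finset.piecewise])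
  obtain ⟨k₁, hk₁, he₁⟩ := exists_eq_update_add_mul hδa i
  obtain ⟨k₂, hk₂, he₂⟩ := exists_eq_update_add_mul hk₁ j
  have hδi : ∀ x : Cn n, δ (Function.update x i 0) = h (Pi.single j (x j)) := fun x => by
    simp only [hδ]
    congr 1
    ext l
    by_cases hl : l = j
    · subst hl; simp [hij.symm, Finset.piecewise]
    · by_cases hl' : l = i
      · subst hl'; simp [hl, Finset.piecewise]
      · simp [hl, hl', Finset.piecewise]
  have hδj : ∀ x : Cn n, δ (Function.update x j 0) = h (Pi.single i (x i)) := fun x => by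
    simp only [hδ]
    congr 1
    ext l
    by_cases hl : l = i
    · subst hl; simp [hij, Finset.piecewise]
    · by_cases hl' : l = j
      · subst hl'; simp [hl, Finset.piecewise]
      · simp [hl, hl', Finset.piecewise]
  have hupd : ContinuousAt (fun x : Cn n => Function.update x j 0) 0 := by fun_prop
  have hupd0 : Function.update (0 : Cn n) j 0 = 0 := by simp
  -- The first division, read at `x j = 0`, gives `x i * k₁ = 0` there. This kills the remainder of
  -- the second division.
  have he₁' := (show Tendsto (fun x : Cn n => Function.update x j 0) (𝓝 0) (𝓝 0) by
    simpa [ContinuousAt, hupd0] using hupd).eventually he₁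
  refine ⟨k₂, k', hk₂, hk', ?_⟩
  filter_upwards [he', he₁, he₂, he₁', eventually_coord_single (p := fun x => h x = 0) hi,
    eventually_coord_single (p := fun x => h x = 0) hj] with x h1 h2 h3 h4 h5 h6
  rw [hδi] at h2
  have h8 : δ (Function.update (Function.update x j 0) i 0) = h 0 := by rw [hδi]; simp
  rw [hδj, h5, h8, Function.update_of_ne hij] at h4
  have h9 : h 0 = 0 := by simpa using hi.self_of_nhds
  rw [h9, zero_add] at h4
  rw [h1]
  change δ x + _ = _
  rw [h2, h6, h3]
  linear_combination -h4

/-- A germ vanishing to order two along all axes belongs to the ideal of the generators. -/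
theorem inGenIdeal_of_axes {α : Cn n → ℂ} (hα : AnalyticAt ℂ α 0)
    (h0 : ∀ i, ∀ᶠ t in 𝓝 (0 : ℂ), α (Pi.single i t) = 0)
    (h1 : ∀ i, ∀ᶠ t in 𝓝 (0 : ℂ), fderiv ℂ α (Pi.single i t) = 0) (h00 : α 0 = 0) :
    InGenIdeal α := by
  obtain ⟨a, ha, hae⟩ := exists_eq_piecewise_add_sum hα Finset.univ
  have hae' : ∀ᶠ x in 𝓝 0, α x = ∑ l, x l * a l x := by
    filter_upwards [hae] with x hx
    simpa [h00] using hx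
  have hai : ∀ i, ∀ᶠ t in 𝓝 (0 : ℂ), a i (Pi.single i t) = 0 := fun i => by
    refine eventually_eq_zero_of_mul ?_ ?_
    · exact ((ha i).comp_of_eq (analyticAt_single i 0) (by simp)).continuousAt
    · filter_upwards [eventually_single hae' i, h0 i] with t ht ht'
      rw [ht', Finset.sum_eq_single i (by intro j _ hj; simp [hj]) (by simp)] at ht
      simpa using ht.symm
  choose b hb hbe using fun i => exists_eq_sum_of_axis (ha i) i (hai i)
  have hαb : ∀ᶠ x in 𝓝 0, α x = ∑ i, ∑ j ∈ Finset.univ.erase i, x i * x j * b i j x := by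
    filter_upwards [hae', eventually_all.2 hbe] with x h2 h3
    rw [h2]
    refine Finset.sum_congr rfl fun i _ => ?_
    rw [h3, Finset.mul_sum]
    exact Finset.sum_congr rfl fun j _ => by ring
  -- Only the symmetrized coefficient of `x i * x j` can be read off from `α`: differentiating `α`
  -- in the direction `j` at the point `t` of the `i`-th axis gives `t * γ i j`, which must vanish.
  let γ : Fin n → Fin n → Cn n → ℂ := fun i j x => b i j x + b j i x
  have hγ : ∀ i j, AnalyticAt ℂ (γ i j) 0 := fun i j => (hb i j).add (hb j i)
  have hγi : ∀ i j, i ≠ j → ∀ᶠ t in 𝓝 (0 : ℂ), γ i j (Pi.single i t) = 0 := fun i j hij => by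
    refine eventually_eq_zero_of_mul ?_ ?_
    · exact ((hγ i j).comp_of_eq (analyticAt_single i 0) (by simp)).continuousAt
    · filter_upwards [eventually_single hαb.eventually_nhds i, h1 i,
        eventually_single hα.eventually_analyticAt i,
        eventually_single (hγ i j).eventually_analyticAt i] with t h2 h3 h4 h5
      have hline : ∀ x : ℂ, HasDerivAt
          (fun s : ℂ => (Pi.single i t + s • Pi.single j 1 : Cn n)) (Pi.single j 1) x := fun x => by
        simpa using ((hasDerivAt_id x).smul_const (Pi.single j 1 : Cn n)).const_add (Pi.single i t)
      have h00 : (Pi.single i t + (0 : ℂ) • Pi.single j 1 : Cn n) = Pi.single i t := by simp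
      have d1 : HasDerivAt (fun s : ℂ => α (Pi.single i t + s • Pi.single j 1)) 0 0 := by
        have := h4.differentiableAt.hasFDerivAt
        rw [h3, ← h00] at this
        exact (this.comp_hasDerivAt (0 : ℂ) (hline 0)).congr_deriv (by simp)
      have d2 : HasDerivAt (fun s : ℂ => (t * s) * γ i j (Pi.single i t + s • Pi.single j 1))
          (t * γ i j (Pi.single i t)) 0 := by
        have := h5.differentiableAt.hasFDerivAt
        rw [← h00] at this
        have := ((hasDerivAt_id (0 : ℂ)).const_mul t).mul (this.comp_hasDerivAt (0 : ℂ) (hline 0))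
        exact this.congr_deriv (by simp)
      have hev : ∀ᶠ s in 𝓝 (0 : ℂ), α (Pi.single i t + s • Pi.single j 1)
          = (t * s) * γ i j (Pi.single i t + s • Pi.single j 1) := by
        have hc := (hline 0).continuousAt.tendsto
        rw [h00] at hc
        filter_upwards [hc.eventually h2] with s hs
        rw [hs]
        set x : Cn n := Pi.single i t + s • Pi.single j 1 with hx
        have hxi : x i = t := by simp [hx, hij]
        have hxj : x j = s := by simp [hx, hij.symm]
        have hxl : ∀ l, l ≠ i → l ≠ j → x l = 0 := fun l h h' => by simp [hx, h, h']
        rw [← Finset.sum_subset (Finset.subset_univ {i, j}), Finset.sum_pair hij,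
          Finset.sum_eq_single j, Finset.sum_eq_single i, hxi, hxj]
        · simp only [γ]; ring
        · intro l hl hl'; rw [hxl l hl' (Finset.ne_of_mem_erase hl)]; ring
        · simp [hij]
        · intro l hl hl'; rw [hxl l (Finset.ne_of_mem_erase hl) hl']; ring
        · simp [hij.symm]
        · intro l _ hl
          simp only [Finset.mem_insert, Finset.mem_singleton, not_or] at hl
          rw [hxl l hl.1 hl.2]; simp
      exact ((d1.congr_of_eventuallyEq (hev.mono fun s hs => hs.symm)).unique d2).symm
  -- By symmetry `γ i j` vanishes on the `i`-th and the `j`-th axis, so it is a combination of `x i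
  -- * x j` and the other coordinates; multiplied by `x i * x j` these become generators.
  have key : ∀ i j, i ≠ j → InGenIdeal fun x => x i * x j * γ i j x := fun i j hij => by
    have hγj : ∀ᶠ t in 𝓝 (0 : ℂ), γ i j (Pi.single j t) = 0 := by
      filter_upwards [hγi j i hij.symm] with t ht
      rw [← ht]; simp only [γ]; ring
    obtain ⟨k, k', hk, hk', he⟩ := exists_eq_of_two_axes (hγ i j) hij (hγi i j hij) hγj
    refine ((InGenIdeal.gen_mul (.pair hij) hk).add (InGenIdeal.sum ({i, j}ᶜ : Finset (Fin n))
      (h := fun l x => x i * x j * (x l * k' l x)) fun l hl => ?_)).congr ?_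
    · simp only [Finset.mem_compl, Finset.mem_insert, Finset.mem_singleton, not_or] at hl
      refine (InGenIdeal.gen_mul (.triple hij hl.1 hl.2) (hk' l)).congr
        (Eventually.of_forall fun x => ?_)
      simp only [gen_triple]; ring
    · filter_upwards [he] with x hx
      rw [hx, mul_add, Finset.mul_sum, gen_pair]; ring
  have hhalf : InGenIdeal fun x => ∑ i, ∑ j ∈ Finset.univ.erase i, x i * x j * γ i j x :=
    InGenIdeal.sum _ fun i _ => InGenIdeal.sum _ fun j hj =>
      key i j (Finset.ne_of_mem_erase hj).symm
  obtain ⟨A, hA, hAe⟩ := hhalf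
  -- The sum over ordered pairs with `γ` in place of `b` counts `α` twice.
  refine ⟨fun t x => 2⁻¹ * A t x, fun t => analyticAt_const.mul (hA t), ?_⟩
  filter_upwards [hαb, hAe] with x h2 h3
  have h4 : ∑ i, ∑ j ∈ Finset.univ.erase i, x i * x j * γ i j x
      = 2 * ∑ i, ∑ j ∈ Finset.univ.erase i, x i * x j * b i j x := by
    have hswap : ∑ i, ∑ j ∈ Finset.univ.erase i, x i * x j * b j i x
        = ∑ i, ∑ j ∈ Finset.univ.erase i, x i * x j * b i j x := by
      rw [Finset.sum_comm' (t' := Finset.univ) (s' := fun j => Finset.univ.erase j)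
        (by intro i j; simp [eq_comm])]
      exact Finset.sum_congr rfl fun i _ => Finset.sum_congr rfl fun j _ => by ring
    rw [two_mul]
    nth_rewrite 2 [← hswap]
    simp only [γ, mul_add, Finset.sum_add_distrib]
  rw [h2]
  have h5 : ∑ t, gen t x * (2⁻¹ * A t x) = 2⁻¹ * ∑ t, gen t x * A t x := by
    rw [Finset.mul_sum]
    exact Finset.sum_congr rfl fun t _ => by ring
  rw [h5, ← h3, h4]
  ring

end Ideal

/-! ### An implicit function theorem and second-order increments -/

section ImplicitFunction

/-- Analytic solutions of `w = M (x, w)` when `M (0, ·)` is constant after two iterations. -/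
theorem exists_analytic_fixedPoint {E W : Type*} [NormedAddCommGroup E] [NormedSpace ℂ E]
    [CompleteSpace E] [NormedAddCommGroup W] [NormedSpace ℂ W] [CompleteSpace W]
    {M : E × W → W} {w₀ : W} (hM : AnalyticAt ℂ M (0, w₀))
    (hconst : ∀ w w', M (0, M (0, w)) = M (0, M (0, w'))) (hw₀ : M (0, w₀) = w₀) :
    ∃ w : E → W, AnalyticAt ℂ w 0 ∧ w 0 = w₀ ∧ ∀ᶠ x in 𝓝 0, M (x, w x) = w x := by
  set u : E × W := (0, w₀) with hu
  set L : W →L[ℂ] W := (fderiv ℂ M u).comp (.inr ℂ E W) with hL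
  have hg : HasFDerivAt (fun w => M (0, w)) L w₀ :=
    HasFDerivAt.comp w₀ (f := fun w : W => ((0, w) : E × W)) hM.differentiableAt.hasFDerivAt
      (hasFDerivAt_prodMk_right 0 w₀)
  -- Differentiating the constant second iterate gives L² = 0, so 1 - L has inverse 1 + L.
  have hLL : L.comp L = 0 := by
    have h1 : HasFDerivAt (fun w => M (0, M (0, w))) (L.comp L) w₀ :=
      HasFDerivAt.comp w₀ (f := fun w => M (0, w)) (g := fun w => M (0, w))
        (by rw [hw₀]; exact hg) hg
    have h2 : (fun w => M (0, M (0, w))) = fun _ => w₀ := by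
      ext1 w
      rw [hconst w w₀, hw₀, hw₀]
    rw [h2] at h1
    exact h1.unique (hasFDerivAt_const w₀ w₀)
  have hf : AnalyticAt ℂ (fun z : E × W => z.2 - M z) u := analyticAt_snd.sub hM
  have hfd : (fderiv ℂ (fun z : E × W => z.2 - M z) u).comp (.inr ℂ E W) = .id ℂ W - L := by
    have : HasFDerivAt (fun z : E × W => z.2 - M z) (.snd ℂ E W - fderiv ℂ M u) u :=
      hasFDerivAt_snd.sub hM.differentiableAt.hasFDerivAt
    rw [this.fderiv, ContinuousLinearMap.sub_comp, ContinuousLinearMap.snd_comp_inr]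
  have hLL' : ∀ x, L (L x) = 0 := fun x => DFunLike.congr_fun hLL x
  have hinv : ((fderiv ℂ (fun z : E × W => z.2 - M z) u).comp (.inr ℂ E W)).IsInvertible := by
    rw [hfd]
    refine ⟨ContinuousLinearEquiv.equivOfInverse (.id ℂ W - L) (.id ℂ W + L) ?_ ?_, rfl⟩ <;>
    · intro x
      simp [hLL']
  have hc : ContDiffAt ℂ ⊤ (fun z : E × W => z.2 - M z) u := hf.contDiffAt
  refine ⟨hc.implicitFunction (by simp) hinv, ?_, hc.implicitFunction_apply_self (by simp) hinv, ?_⟩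
  · exact (hc.contDiffAt_implicitFunction (by simp) hinv).analyticAt
  · filter_upwards [hc.eventually_apply_implicitFunction (by simp) hinv] with x hx
    replace hx : _ - M _ = w₀ - M (0, w₀) := hx
    rw [hw₀, sub_self] at hx
    exact (sub_eq_zero.1 hx).symm

theorem analyticAt_dslope {f : ℂ → ℂ} (hf : AnalyticAt ℂ f 0) : AnalyticAt ℂ (dslope f 0) 0 := by
  obtain ⟨p, hp⟩ := hf
  exact ⟨_, hp.has_fpower_series_dslope_fslope⟩

theorem eq_add_mul_dslope (f : ℂ → ℂ) (x : ℂ) : f x = f 0 + x * dslope f 0 x := by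
  have := sub_smul_dslope f 0 x
  simp only [sub_zero, smul_eq_mul] at this
  rw [this]; ring

/-- Second order expansion of the increment of a function with a critical point. -/
theorem exists_increment {f : ℂ → ℂ} (hf : AnalyticAt ℂ f 0) (hd : deriv f 0 = 0) :
    ∃ (a : ℂ → ℂ) (b : ℂ × ℂ → ℂ), AnalyticAt ℂ a 0 ∧ AnalyticAt ℂ b 0 ∧
      a 0 = deriv (deriv f) 0 ∧
      ∀ᶠ z : ℂ × ℂ in 𝓝 0, f (z.1 + z.2) - f z.1 = z.2 * (z.1 * a z.1) + z.2 ^ 2 * b z := by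
  have hh : AnalyticAt ℂ (fun z : ℂ × ℂ => f (z.1 + z.2)) 0 := by
    have : AnalyticAt ℂ (fun z : ℂ × ℂ => z.1 + z.2) 0 := by fun_prop
    exact hf.comp_of_eq this (by simp)
  obtain ⟨h₁, hh₁, he₁⟩ := exists_eq_add_mul hh
  obtain ⟨b, hb, he₂⟩ := exists_eq_add_mul hh₁
  -- The linear coefficient of the increment at `x` is f'(x), which is divisible by `x` because
  -- f'(0) = 0.
  refine ⟨dslope (deriv f) 0, b, analyticAt_dslope hf.deriv, hb, dslope_same _ _, ?_⟩
  have hin : Tendsto (fun x : ℂ => ((x, 0) : ℂ × ℂ)) (𝓝 0) (𝓝 0) := by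
    have : Continuous (fun x : ℂ => ((x, 0) : ℂ × ℂ)) := by fun_prop
    exact this.tendsto' _ _ rfl
  have hd1 : ∀ᶠ x in 𝓝 (0 : ℂ), h₁ (x, 0) = deriv f x := by
    filter_upwards [hin.eventually he₁.eventually_nhds, hin.eventually hh₁.eventually_analyticAt,
      hf.eventually_analyticAt] with x h1 h2 h3
    have hs : HasDerivAt (fun s : ℂ => ((x, s) : ℂ × ℂ)) (0, 1) 0 :=
      (hasDerivAt_const _ _).prodMk (hasDerivAt_id _)
    have d1 : HasDerivAt (fun s : ℂ => f (x + s)) (deriv f x) 0 := by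
      have := h3.differentiableAt.hasDerivAt
      rw [← add_zero x] at this
      simpa using this.comp_const_add x 0
    have d2 : HasDerivAt (fun s : ℂ => f x + s * h₁ (x, s)) (h₁ (x, 0)) 0 := by
      have d3 : DifferentiableAt ℂ (fun s : ℂ => h₁ (x, s)) 0 :=
        DifferentiableAt.comp (0 : ℂ) (f := fun s : ℂ => ((x, s) : ℂ × ℂ)) h2.differentiableAt
          hs.differentiableAt
      exact (((hasDerivAt_id (0 : ℂ)).mul d3.hasDerivAt).const_add (f x)).congr_deriv (by simp)
    have hev : ∀ᶠ s in 𝓝 (0 : ℂ), f (x + s) = f x + s * h₁ (x, s) := by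
      filter_upwards [hs.continuousAt.tendsto.eventually h1] with s h
      simpa using h
    exact (d1.congr_of_eventuallyEq (hev.mono fun s hs => hs.symm)).unique d2 |>.symm
  have hd1' : ∀ᶠ z : ℂ × ℂ in 𝓝 0, h₁ (z.1, 0) = deriv f z.1 :=
    (continuous_fst.tendsto (0 : ℂ × ℂ)).eventually hd1
  filter_upwards [he₁, he₂, hd1'] with z h1 h2 h3
  rw [h1, h2, h3, eq_add_mul_dslope (deriv f) z.1, hd]
  simp only [add_zero]
  ring

end ImplicitFunction

/-! ### Displacements with unknown coefficients and their squares -/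

section Solve

variable {n : ℕ}

/-- The space of unknown coefficients. -/
abbrev Coeff (n : ℕ) : Type := GenIdx n → ℂ × ℂ

/-- `t` is the index of a generator `xᵢ xⱼ xₗ`. -/
def GenIdx.IsTriple (t : GenIdx n) : Prop := t.1.2.2 ≠ none

/-- The two coefficient vectors agree at the generators `xᵢ xⱼ xₗ`. -/
def AgreeOnTriples (w w' : Coeff n) : Prop := ∀ t : GenIdx n, t.IsTriple → w t = w' t

/-- Membership in the ideal of the generators with parameters, with control of the coefficients
at `x = 0`. -/
def Triangular (h : Cn n × Coeff n → ℂ) : Prop :=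
  ∃ q : GenIdx n → Cn n × Coeff n → ℂ, (∀ t z, AnalyticAt ℂ (q t) z) ∧
    (∀ z, h z = ∑ t, gen t z.1 * q t z) ∧
    (∀ t w, t.IsTriple → q t (0, w) = 0) ∧
    ∀ t w w', AgreeOnTriples w w' → q t (0, w) = q t (0, w')

theorem Triangular.gen_mul (t : GenIdx n) {q : Cn n × Coeff n → ℂ} (hq : ∀ z, AnalyticAt ℂ q z)
    (h0 : ∀ w, t.IsTriple → q (0, w) = 0)
    (h1 : ∀ w w', AgreeOnTriples w w' → q (0, w) = q (0, w')) {h : Cn n × Coeff n → ℂ}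
    (he : ∀ z, h z = gen t z.1 * q z) : Triangular h := by
  refine ⟨fun u => if u = t then q else fun _ => 0, fun u z => ?_, fun z => ?_, fun u w hu => ?_,
    fun u w w' hw => ?_⟩
  · by_cases h : u = t
    · simpa [h] using hq z
    · simpa [h] using analyticAt_const
  · rw [he, Finset.sum_eq_single t] <;> simp +contextual
  · by_cases h : u = t
    · subst h; simpa using h0 w hu
    · simp [h]
  · by_cases h : u = t
    · simpa [h] using h1 w w' hw
    · simp [h]

theorem Triangular.zero : Triangular (fun _ : Cn n × Coeff n => 0) :=
  ⟨fun _ _ => 0, fun _ _ => analyticAt_const, by simp, by simp, by simp⟩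

theorem Triangular.add {h k : Cn n × Coeff n → ℂ} (hh : Triangular h) (hk : Triangular k) :
    Triangular fun z => h z + k z := by
  obtain ⟨q, hq, he, h0, h1⟩ := hh
  obtain ⟨q', hq', he', h0', h1'⟩ := hk
  refine ⟨fun t z => q t z + q' t z, fun t z => (hq t z).add (hq' t z), fun z => ?_,
    fun t w ht => by simp [h0 t w ht, h0' t w ht],
    fun t w w' hw => by simp only [h1 t w w' hw, h1' t w w' hw]⟩
  simp only [he, he', ← Finset.sum_add_distrib]
  exact Finset.sum_congr rfl fun t _ => by ring

theorem Triangular.sum {ι : Type*} (s : Finset ι) {h : ι → Cn n × Coeff n → ℂ}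
    (hh : ∀ i ∈ s, Triangular (h i)) : Triangular fun z => ∑ i ∈ s, h i z := by
  classical
  induction s using Finset.induction_on with
  | empty => simpa using Triangular.zero
  | insert i s hi ih =>
    simp only [Finset.sum_insert hi]
    exact (hh i (by simp)).add (ih fun j hj => hh j (by simp [hj]))

/-- The terms allowed in the `k`-th component of the displacement: `x_a x_b ω` with `k`, `a`, `b`
distinct, or `x_k x_a² ω` with `a ≠ k`. -/
inductive IsDisplacementTerm (k : Fin n) : (Cn n × Coeff n → ℂ) → Prop
  | zero : IsDisplacementTerm k fun _ => 0
  | cross {a b : Fin n} (ω : Coeff n → ℂ) (hab : a ≠ b) (ha : a ≠ k) (hb : b ≠ k)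
      (hω : ∀ w, AnalyticAt ℂ ω w) (hω' : ∀ w w', AgreeOnTriples w w' → ω w = ω w') :
      IsDisplacementTerm k fun z => z.1 a * z.1 b * ω z.2
  | radial {a : Fin n} (ω : Coeff n → ℂ) (ha : a ≠ k) (hω : ∀ w, AnalyticAt ℂ ω w) :
      IsDisplacementTerm k fun z => z.1 k * z.1 a ^ 2 * ω z.2

theorem analyticAt_coeff {ω : Coeff n → ℂ} (hω : ∀ w, AnalyticAt ℂ ω w) (z : Cn n × Coeff n) :
    AnalyticAt ℂ (fun z : Cn n × Coeff n => ω z.2) z :=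
  (hω z.2).comp_of_eq analyticAt_snd rfl

/-- A multiple of a generator whose coefficient vanishes at `x = 0`. -/
theorem Triangular.of_coord_mul (t : GenIdx n) (i : Fin n) {ω : Cn n × Coeff n → ℂ}
    (hω : ∀ z, AnalyticAt ℂ ω z) {h : Cn n × Coeff n → ℂ}
    (he : ∀ z, h z = gen t z.1 * (z.1 i * ω z)) : Triangular h := by
  refine Triangular.gen_mul t (fun z => ?_) (by simp) (by simp) he
  have := hω z
  fun_prop

/-- If {a, b} = {c, d}, the product is a multiple of x_a² x_b² whose coefficient involves only the
unknowns at triples. Otherwise `c` or `d` lies outside {a, b} and supplies the third factor of a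
triple generator; the remaining coordinate makes the coefficient vanish at `x = 0`. -/
theorem IsDisplacementTerm.cross_mul_cross {a b c d : Fin n} {ω ω' : Coeff n → ℂ}
    (hab : a ≠ b) (hcd : c ≠ d)
    (hω : ∀ w, AnalyticAt ℂ ω w) (hω1 : ∀ w w', AgreeOnTriples w w' → ω w = ω w')
    (hω' : ∀ w, AnalyticAt ℂ ω' w) (hω1' : ∀ w w', AgreeOnTriples w w' → ω' w = ω' w') :
    Triangular fun z : Cn n × Coeff n => (z.1 a * z.1 b * ω z.2) * (z.1 c * z.1 d * ω' z.2) := by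
  have hωω : ∀ z : Cn n × Coeff n, AnalyticAt ℂ (fun z : Cn n × Coeff n => ω z.2 * ω' z.2) z :=
    fun z => (analyticAt_coeff hω z).mul (analyticAt_coeff hω' z)
  by_cases h1 : c = a ∨ c = b
  · by_cases h2 : d = a ∨ d = b
    · refine Triangular.gen_mul (.pair hab) hωω (fun w ht => absurd rfl ht)
        (fun w w' hw => by simp only [hω1 w w' hw, hω1' w w' hw]) fun z => ?_
      rw [gen_pair]
      rcases h1 with rfl | rfl <;> rcases h2 with rfl | rfl
      · exact absurd rfl hcd
      · ring
      · ring
      · exact absurd rfl hcd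
    · push Not at h2
      refine Triangular.of_coord_mul (.triple hab h2.1 h2.2) c hωω fun z => ?_
      rw [gen_triple]; ring
  · push Not at h1
    refine Triangular.of_coord_mul (.triple hab h1.1 h1.2) d hωω fun z => ?_
    rw [gen_triple]; ring

/-- The indices `k`, `a`, `b` are distinct, so a triple generator factors out, and `x c` squared is
left over. -/
theorem IsDisplacementTerm.cross_mul_radial {k a b c : Fin n} {ω ω' : Coeff n → ℂ}
    (hab : a ≠ b) (ha : a ≠ k) (hb : b ≠ k)
    (hω : ∀ w, AnalyticAt ℂ ω w) (hω' : ∀ w, AnalyticAt ℂ ω' w) :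
    Triangular fun z : Cn n × Coeff n =>
      (z.1 a * z.1 b * ω z.2) * (z.1 k * z.1 c ^ 2 * ω' z.2) := by
  refine Triangular.of_coord_mul (.triple hab ha.symm hb.symm) c
    (ω := fun z => z.1 c * (ω z.2 * ω' z.2)) (fun z => ?_) fun z => ?_
  · have h1 := analyticAt_coeff hω z
    have h2 := analyticAt_coeff hω' z
    have h3 : AnalyticAt ℂ (fun z : Cn n × Coeff n => z.1 c) z := by fun_prop
    exact h3.mul (h1.mul h2)
  · rw [gen_triple]; ring

/-- This is the source of the triangular structure: the only products with a coefficient surviving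
at `x = 0` are those of two cross terms on the same pair of indices. They feed pair generators with
unknowns at triples, never the reverse. Two radial terms share x_k² and give the generator x_a² x_k²
times a square. -/
theorem IsDisplacementTerm.mul {k : Fin n} {h h' : Cn n × Coeff n → ℂ}
    (hh : IsDisplacementTerm k h) (hh' : IsDisplacementTerm k h') :
    Triangular fun z => h z * h' z := by
  cases hh with
  | zero => simpa using Triangular.zero
  | cross ω hab ha hb hω hω1 =>
    cases hh' with
    | zero => simpa using Triangular.zero
    | cross ω' hcd hc hd hω' hω1' => exact cross_mul_cross hab hcd hω hω1 hω' hω1'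
    | radial ω' hc hω' => exact cross_mul_radial hab ha hb hω hω'
  | @radial a ω ha hω =>
    cases hh' with
    | zero => simpa using Triangular.zero
    | cross ω' hcd hc hd hω' hω1' =>
      simp only [mul_comm (_ * ω _)]
      exact cross_mul_radial hcd hc hd hω' hω
    | @radial c ω' hc hω' =>
      refine Triangular.of_coord_mul (.pair ha) c
        (ω := fun z => z.1 c * (ω z.2 * ω' z.2)) (fun z => ?_) fun z => ?_
      · have h1 := analyticAt_coeff hω z
        have h2 := analyticAt_coeff hω' z
        have h3 : AnalyticAt ℂ (fun z : Cn n × Coeff n => z.1 c) z := by fun_prop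
        exact h3.mul (h1.mul h2)
      · rw [gen_pair]; ring

theorem analyticAt_coeff_fst (t : GenIdx n) (w : Coeff n) :
    AnalyticAt ℂ (fun w : Coeff n => (w t).1) w :=
  ((ContinuousLinearMap.fst ℂ ℂ ℂ).comp
    (ContinuousLinearMap.proj (R := ℂ) (φ := fun _ : GenIdx n => ℂ × ℂ) t)).analyticAt w

theorem analyticAt_coeff_snd (t : GenIdx n) (w : Coeff n) :
    AnalyticAt ℂ (fun w : Coeff n => (w t).2) w :=
  ((ContinuousLinearMap.snd ℂ ℂ ℂ).comp
    (ContinuousLinearMap.proj (R := ℂ) (φ := fun _ : GenIdx n => ℂ × ℂ) t)).analyticAt w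

/-- The contribution of the first coefficient at `t` to the `k`-th component. -/
def displacementFst (k : Fin n) (t : GenIdx n) (z : Cn n × Coeff n) : ℂ :=
  if t.1.1 = k then z.1 t.1.2.1 * cofactor t z.1 * (z.2 t).1 else 0

/-- The contribution of the second coefficient at `t` to the `k`-th component. -/
def displacementSnd (k : Fin n) (t : GenIdx n) (z : Cn n × Coeff n) : ℂ :=
  if t.1.2.1 = k then z.1 t.1.1 * cofactor t z.1 * (z.2 t).2 else 0

/-- The `k`-th component of the displacement with given coefficients. -/
def displacement (k : Fin n) (z : Cn n × Coeff n) : ℂ :=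
  ∑ t, (displacementFst k t z + displacementSnd k t z)

/-- Unknowns at triples produce cross terms, unknowns at pairs produce radial terms. -/
theorem isDisplacementTerm_fst (k : Fin n) (t : GenIdx n) :
    IsDisplacementTerm k (displacementFst k t) := by
  unfold displacementFst
  split_ifs with h
  · obtain ⟨⟨i, j, _ | l⟩, hij, hl⟩ := t
    · subst h
      convert IsDisplacementTerm.radial (k := i) (a := j) _ hij.symm
        (analyticAt_coeff_fst ⟨(i, j, none), hij, hl⟩) using 2 with z
      simp only [cofactor]; ring
    · subst h
      refine IsDisplacementTerm.cross (k := i) (a := j) (b := l) (fun w => _) (hl l rfl).2.symm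
        hij.symm (hl l rfl).1 (analyticAt_coeff_fst _) fun w w' hw => ?_
      rw [hw _ (by simp [GenIdx.IsTriple])]
  · exact .zero

theorem isDisplacementTerm_snd (k : Fin n) (t : GenIdx n) :
    IsDisplacementTerm k (displacementSnd k t) := by
  unfold displacementSnd
  split_ifs with h
  · obtain ⟨⟨i, j, _ | l⟩, hij, hl⟩ := t
    · subst h
      convert IsDisplacementTerm.radial (k := j) (a := i) _ hij
        (analyticAt_coeff_snd ⟨(i, j, none), hij, hl⟩) using 2 with z
      simp only [cofactor]; ring
    · subst h
      refine IsDisplacementTerm.cross (k := j) (a := i) (b := l) (fun w => _) (hl l rfl).1.symm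
        hij (hl l rfl).2 (analyticAt_coeff_snd _) fun w w' hw => ?_
      rw [hw _ (by simp [GenIdx.IsTriple])]
  · exact .zero

/-- The second-order remainder of a function of x_k under the displacement is a multiple of this
square, so it can be corrected within the same ideal. -/
theorem triangular_displacement_sq (k : Fin n) :
    Triangular fun z : Cn n × Coeff n => displacement k z ^ 2 := by
  have : (fun z : Cn n × Coeff n => displacement k z ^ 2) = fun z => ∑ t, ∑ u,
      ((displacementFst k t z * displacementFst k u z
        + displacementFst k t z * displacementSnd k u z)
      + (displacementSnd k t z * displacementFst k u z
        + displacementSnd k t z * displacementSnd k u z)) := by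
    ext1 z
    rw [displacement, sq, Finset.sum_mul_sum]
    exact Finset.sum_congr rfl fun t _ => Finset.sum_congr rfl fun u _ => by ring
  rw [this]
  refine Triangular.sum _ fun t _ => Triangular.sum _ fun u _ => .add (.add ?_ ?_) (.add ?_ ?_)
  · exact (isDisplacementTerm_fst k t).mul (isDisplacementTerm_fst k u)
  · exact (isDisplacementTerm_fst k t).mul (isDisplacementTerm_snd k u)
  · exact (isDisplacementTerm_snd k t).mul (isDisplacementTerm_fst k u)
  · exact (isDisplacementTerm_snd k t).mul (isDisplacementTerm_snd k u)

/-- The displacement is designed for this identity. Each contribution at `t` is the generator with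
one of its two leading coordinates removed, and multiplying by that coordinate restores the
generator. The linear part of the system thus decouples, with two unknowns per generator. -/
theorem sum_coord_mul_displacement (z : Cn n × Coeff n) (a : Fin n → ℂ) :
    ∑ k, displacement k z * (z.1 k * a k)
      = ∑ t, gen t z.1 * (a t.1.1 * (z.2 t).1 + a t.1.2.1 * (z.2 t).2) := by
  simp only [displacement, Finset.sum_mul]
  rw [Finset.sum_comm]
  refine Finset.sum_congr rfl fun t _ => ?_
  simp only [displacementFst, displacementSnd, add_mul, Finset.sum_add_distrib, ite_mul, zero_mul,
    Finset.sum_ite_eq, Finset.mem_univ, if_true, gen]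
  ring

end Solve

/-! ### Absorbing errors that lie in the ideal -/

section NormalForm

variable {n : ℕ}

theorem cofactor_zero (t : GenIdx n) : cofactor t 0 = 0 := by
  unfold cofactor
  split <;> simp

theorem analyticAt_cofactor (t : GenIdx n) (x : Cn n) : AnalyticAt ℂ (cofactor t) x := by
  unfold cofactor
  split <;> fun_prop

theorem displacement_zero (k : Fin n) (w : Coeff n) : displacement k (0, w) = 0 := by
  simp [displacement, displacementFst, displacementSnd]

theorem analyticAt_displacementFst (k : Fin n) (t : GenIdx n) (z : Cn n × Coeff n) :
    AnalyticAt ℂ (displacementFst k t) z := by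
  unfold displacementFst
  split_ifs
  · have h1 := analyticAt_coeff (analyticAt_coeff_fst t) z
    have h2 : AnalyticAt ℂ (fun z : Cn n × Coeff n => cofactor t z.1) z :=
      (analyticAt_cofactor t z.1).comp_of_eq analyticAt_fst rfl
    have h3 : AnalyticAt ℂ (fun z : Cn n × Coeff n => z.1 t.1.2.1) z := by fun_prop
    exact (h3.mul h2).mul h1
  · exact analyticAt_const

theorem analyticAt_displacementSnd (k : Fin n) (t : GenIdx n) (z : Cn n × Coeff n) :
    AnalyticAt ℂ (displacementSnd k t) z := by
  unfold displacementSnd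
  split_ifs
  · have h1 := analyticAt_coeff (analyticAt_coeff_snd t) z
    have h2 : AnalyticAt ℂ (fun z : Cn n × Coeff n => cofactor t z.1) z :=
      (analyticAt_cofactor t z.1).comp_of_eq analyticAt_fst rfl
    have h3 : AnalyticAt ℂ (fun z : Cn n × Coeff n => z.1 t.1.1) z := by fun_prop
    exact (h3.mul h2).mul h1
  · exact analyticAt_const

theorem analyticAt_displacement (k : Fin n) (z : Cn n × Coeff n) :
    AnalyticAt ℂ (displacement k) z :=
  Finset.analyticAt_fun_sum _ fun t _ =>
    (analyticAt_displacementFst k t z).add (analyticAt_displacementSnd k t z)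

theorem hasFDerivAt_mul_of_zero {E : Type*} [NormedAddCommGroup E] [NormedSpace ℂ E]
    {u v : E → ℂ} (hu : AnalyticAt ℂ u 0) (hv : AnalyticAt ℂ v 0) (hu0 : u 0 = 0) (hv0 : v 0 = 0) :
    HasFDerivAt (fun x => u x * v x) (0 : E →L[ℂ] ℂ) 0 := by
  have := hu.differentiableAt.hasFDerivAt.mul hv.differentiableAt.hasFDerivAt
  exact this.congr_fderiv (by ext; simp [hu0, hv0])

/-- Every term is the product of a coordinate and a cofactor, both zero at the origin. Adding the
displacement therefore keeps the derivative of the identity. -/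
theorem hasFDerivAt_displacement (k : Fin n) {w : Cn n → Coeff n} (hw : AnalyticAt ℂ w 0) :
    HasFDerivAt (fun x => displacement k (x, w x)) (0 : Cn n →L[ℂ] ℂ) 0 := by
  have h1 : ∀ t : GenIdx n, AnalyticAt ℂ (fun x => (w x t).1) 0 := fun t =>
    (analyticAt_coeff_fst t (w 0)).comp_of_eq hw rfl
  have h2 : ∀ t : GenIdx n, AnalyticAt ℂ (fun x => (w x t).2) 0 := fun t =>
    (analyticAt_coeff_snd t (w 0)).comp_of_eq hw rfl
  have hsum : HasFDerivAt (fun x => displacement k (x, w x))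
      (∑ _t : GenIdx n, (0 + 0 : Cn n →L[ℂ] ℂ)) 0 := by
    refine HasFDerivAt.fun_sum fun t _ => HasFDerivAt.add ?_ ?_
    · unfold displacementFst
      split_ifs
      · simp only [mul_assoc]
        exact hasFDerivAt_mul_of_zero (by fun_prop) ((analyticAt_cofactor t 0).mul (h1 t)) rfl
          (by simp [cofactor_zero])
      · exact hasFDerivAt_const _ _
    · unfold displacementSnd
      split_ifs
      · simp only [mul_assoc]
        exact hasFDerivAt_mul_of_zero (by fun_prop) ((analyticAt_cofactor t 0).mul (h2 t)) rfl
          (by simp [cofactor_zero])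
      · exact hasFDerivAt_const _ _
  simpa using hsum

/-- Two functions that agree with sums of functions of one coordinate up to the ideal of the
generators are simultaneously brought to these sums. -/
theorem exists_diffGerm_of_inGenIdeal {F G : Fin n → ℂ → ℂ} (hF : ∀ k, AnalyticAt ℂ (F k) 0)
    (hG : ∀ k, AnalyticAt ℂ (G k) 0) (hF' : ∀ k, deriv (F k) 0 = 0) (hG' : ∀ k, deriv (G k) 0 = 0)
    (hFG : ∀ i j, i ≠ j → deriv (deriv (F i)) 0 * deriv (deriv (G j)) 0
      - deriv (deriv (F j)) 0 * deriv (deriv (G i)) 0 ≠ 0)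
    {f g : Cn n → ℂ} (hf : InGenIdeal fun x => f x - ∑ k, F k (x k))
    (hg : InGenIdeal fun x => g x - ∑ k, G k (x k)) :
    ∃ φ : Cn n → Cn n, IsDiffGerm φ ∧
      ∀ᶠ x in 𝓝 0, f x = ∑ k, F k (φ x k) ∧ g x = ∑ k, G k (φ x k) := by
  obtain ⟨A, hA, hAe⟩ := hf
  obtain ⟨B, hB, hBe⟩ := hg
  choose aF bF haF hbF haF0 hFe using fun k => exists_increment (hF k) (hF' k)
  choose aG bG haG hbG haG0 hGe using fun k => exists_increment (hG k) (hG' k)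
  choose q hq hqe hq0 hq1 using fun k : Fin n => triangular_displacement_sq k
  -- `P` and `Q` are what the linear terms must produce on each generator: the error to be absorbed
  -- minus the contribution of the quadratic remainder.
  let P : GenIdx n → Cn n × Coeff n → ℂ := fun t z =>
    A t z.1 - ∑ k, bF k (z.1 k, displacement k z) * q k t z
  let Q : GenIdx n → Cn n × Coeff n → ℂ := fun t z =>
    B t z.1 - ∑ k, bG k (z.1 k, displacement k z) * q k t z
  let D : GenIdx n → Cn n → ℂ := fun t x =>
    aF t.1.1 (x t.1.1) * aG t.1.2.1 (x t.1.2.1) - aF t.1.2.1 (x t.1.2.1) * aG t.1.1 (x t.1.1)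
  -- Cramer's rule for the two equations at `t`, with right-hand sides `P t`, `Q t` and determinant
  -- `D t`. A fixed point of `M (x, ·)` solves the full nonlinear system.
  let M : Cn n × Coeff n → Coeff n := fun z t =>
    ((aG t.1.2.1 (z.1 t.1.2.1) * P t z - aF t.1.2.1 (z.1 t.1.2.1) * Q t z) / D t z.1,
      (aF t.1.1 (z.1 t.1.1) * Q t z - aG t.1.1 (z.1 t.1.1) * P t z) / D t z.1)
  have hD0 : ∀ t, D t 0 ≠ 0 := fun t => by
    simp only [D, Pi.zero_apply, haF0, haG0]
    exact hFG _ _ t.2.1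
  have hP0 : ∀ t w, P t (0, w) = A t 0 - ∑ k, bF k (0, 0) * q k t (0, w) := fun t w => by
    simp [P, displacement_zero]
  have hQ0 : ∀ t w, Q t (0, w) = B t 0 - ∑ k, bG k (0, 0) * q k t (0, w) := fun t w => by
    simp [Q, displacement_zero]
  -- At `x = 0` the entries of `M` at triples are constant and the others depend only on the
  -- unknowns at triples. Hence the second iterate is constant, and its value `w₀` is a fixed point.
  have hM1 : ∀ w w', AgreeOnTriples (M (0, w)) (M (0, w')) := fun w w' t ht => by
    simp only [M, hP0, hQ0, hq0 _ t _ ht]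
  have hM2 : ∀ w w', AgreeOnTriples w w' → M (0, w) = M (0, w') := fun w w' h => by
    ext1 t
    simp only [M, hP0, hQ0, hq1 _ t w w' h]
  have hM3 : ∀ w w', M (0, M (0, w)) = M (0, M (0, w')) := fun w w' => hM2 _ _ (hM1 w w')
  set w₀ : Coeff n := M (0, M (0, 0)) with hw₀
  have hcoord : ∀ k : Fin n, AnalyticAt ℂ (fun z : Cn n × Coeff n => z.1 k) (0, w₀) := fun k => by
    fun_prop
  have hone : ∀ (c : ℂ → ℂ) (k : Fin n), AnalyticAt ℂ c 0 →
      AnalyticAt ℂ (fun z : Cn n × Coeff n => c (z.1 k)) (0, w₀) := fun c k hc =>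
    hc.comp_of_eq (hcoord k) rfl
  have hfst : ∀ {c : Cn n → ℂ}, AnalyticAt ℂ c 0 →
      AnalyticAt ℂ (fun z : Cn n × Coeff n => c z.1) (0, w₀) := fun hc =>
    hc.comp_of_eq analyticAt_fst rfl
  have htwo : ∀ (c : ℂ × ℂ → ℂ) (k : Fin n), AnalyticAt ℂ c 0 →
      AnalyticAt ℂ (fun z : Cn n × Coeff n => c (z.1 k, displacement k z)) (0, w₀) :=
    fun c k hc => hc.comp_of_eq ((hcoord k).prod (analyticAt_displacement k _))
      (by simp [displacement_zero])
  have hP : ∀ t, AnalyticAt ℂ (P t) (0, w₀) := fun t =>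
    (hfst (hA t)).sub (Finset.analyticAt_fun_sum _ fun k _ => (htwo _ k (hbF k)).mul (hq k t _))
  have hQ : ∀ t, AnalyticAt ℂ (Q t) (0, w₀) := fun t =>
    (hfst (hB t)).sub (Finset.analyticAt_fun_sum _ fun k _ => (htwo _ k (hbG k)).mul (hq k t _))
  have hD : ∀ t, AnalyticAt ℂ (fun z : Cn n × Coeff n => D t z.1) (0, w₀) := fun t =>
    ((hone _ _ (haF _)).mul (hone _ _ (haG _))).sub ((hone _ _ (haF _)).mul (hone _ _ (haG _)))
  have hM : AnalyticAt ℂ M (0, w₀) := by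
    refine AnalyticAt.pi fun t => AnalyticAt.prod ?_ ?_
    · exact (((hone _ _ (haG _)).mul (hP t)).sub ((hone _ _ (haF _)).mul (hQ t))).div (hD t)
        (hD0 t)
    · exact (((hone _ _ (haF _)).mul (hQ t)).sub ((hone _ _ (haG _)).mul (hP t))).div (hD t)
        (hD0 t)
  obtain ⟨w, hw, hw0, hwe⟩ := exists_analytic_fixedPoint hM hM3 (hM3 _ _)
  have hxw : AnalyticAt ℂ (fun x => (x, w x)) 0 := analyticAt_id.prod hw
  have hdisp : ∀ k, AnalyticAt ℂ (fun x => displacement k (x, w x)) 0 := fun k =>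
    (analyticAt_displacement k _).comp_of_eq hxw rfl
  let φ : Cn n → Cn n := fun x k => x k + displacement k (x, w x)
  have hφd : HasFDerivAt φ (.id ℂ (Cn n)) 0 := by
    rw [hasFDerivAt_pi']
    intro k
    have := ((ContinuousLinearMap.proj (R := ℂ) (φ := fun _ : Fin n => ℂ) k).hasFDerivAt
      (x := (0 : Cn n))).add (hasFDerivAt_displacement k hw)
    rw [add_zero] at this
    exact this
  refine ⟨φ, ⟨AnalyticAt.pi fun k => ?_, ?_, ?_⟩, ?_⟩
  · have := hdisp k
    fun_prop
  · ext k
    simp [φ, displacement_zero]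
  · rw [hφd.fderiv]
    exact ⟨ContinuousLinearEquiv.refl ℂ (Cn n), rfl⟩
  · have hpt : ∀ k, Tendsto (fun x : Cn n => (x k, displacement k (x, w x))) (𝓝 0) (𝓝 (0, 0)) :=
      fun k => by
        have h1 : AnalyticAt ℂ (fun x : Cn n => x k) 0 := by fun_prop
        have := (h1.prod (hdisp k)).continuousAt.tendsto
        simp only [displacement_zero] at this
        exact this
    have hDne : ∀ᶠ x in 𝓝 (0 : Cn n), ∀ t, D t x ≠ 0 := by
      refine eventually_all.2 fun t => ?_
      have : ContinuousAt (D t) 0 := by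
        have h1 : ∀ (c : ℂ → ℂ) (k : Fin n), AnalyticAt ℂ c 0 →
          AnalyticAt ℂ (fun x : Cn n => c (x k)) 0 := fun c k hc =>
            hc.comp_of_eq (analyticAt_coord k 0) rfl
        exact (((h1 _ _ (haF _)).mul (h1 _ _ (haG _))).sub
          ((h1 _ _ (haF _)).mul (h1 _ _ (haG _)))).continuousAt
      exact this.eventually_ne (hD0 t)
    filter_upwards [hAe, hBe, hwe, hDne, eventually_all.2 fun k => (hpt k).eventually (hFe k),
      eventually_all.2 fun k => (hpt k).eventually (hGe k)] with x h1 h2 h3 h4 h5 h6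
    have e0 : ∀ t, w x t
        = ((aG t.1.2.1 (x t.1.2.1) * P t (x, w x) - aF t.1.2.1 (x t.1.2.1) * Q t (x, w x)) / D t x,
          (aF t.1.1 (x t.1.1) * Q t (x, w x) - aG t.1.1 (x t.1.1) * P t (x, w x)) / D t x) :=
      fun t => (congrFun h3 t).symm
    have e1 : ∀ t, aF t.1.1 (x t.1.1) * (w x t).1 + aF t.1.2.1 (x t.1.2.1) * (w x t).2
        = P t (x, w x) := fun t => by
      have := h4 t
      rw [e0, mul_div_assoc', mul_div_assoc', ← add_div, div_eq_iff this]
      simp only [D]; ring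
    have e2 : ∀ t, aG t.1.1 (x t.1.1) * (w x t).1 + aG t.1.2.1 (x t.1.2.1) * (w x t).2
        = Q t (x, w x) := fun t => by
      have := h4 t
      rw [e0, mul_div_assoc', mul_div_assoc', ← add_div, div_eq_iff this]
      simp only [D]; ring
    have hquad : ∀ b : Fin n → ℂ, ∑ k, displacement k (x, w x) ^ 2 * b k
        = ∑ t, gen t x * ∑ k, b k * q k t (x, w x) := fun b => by
      simp only [fun k => hqe k (x, w x), Finset.sum_mul, Finset.mul_sum]
      rw [Finset.sum_comm]
      exact Finset.sum_congr rfl fun t _ => Finset.sum_congr rfl fun k _ => by ring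
    constructor
    · have h7 : ∑ k, F k (φ x k) - ∑ k, F k (x k) = ∑ t, gen t x * A t x := by
        rw [← Finset.sum_sub_distrib]
        simp only [φ, h5, Finset.sum_add_distrib, hquad]
        rw [sum_coord_mul_displacement (x, w x) fun k => aF k (x k), ← Finset.sum_add_distrib]
        refine Finset.sum_congr rfl fun t _ => ?_
        rw [e1]
        simp only [P]; ring
      rw [← h1] at h7
      linear_combination -h7
    · have h7 : ∑ k, G k (φ x k) - ∑ k, G k (x k) = ∑ t, gen t x * B t x := by
        rw [← Finset.sum_sub_distrib]
        simp only [φ, h6, Finset.sum_add_distrib, hquad]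
        rw [sum_coord_mul_displacement (x, w x) fun k => aG k (x k), ← Finset.sum_add_distrib]
        refine Finset.sum_congr rfl fun t _ => ?_
        rw [e2]
        simp only [Q]; ring
      rw [← h2] at h7
      linear_combination -h7

end NormalForm

/-! ### Germs of diffeomorphisms -/

section DiffGerm

variable {E : Type*} [NormedAddCommGroup E] [NormedSpace ℂ E]

theorem IsDiffGerm.tendsto {φ : E → E} (hφ : IsDiffGerm φ) : Tendsto φ (𝓝 0) (𝓝 0) := by
  have := hφ.1.continuousAt.tendsto
  rwa [hφ.2.1] at this

theorem IsDiffGerm.comp {φ ψ : E → E} (hφ : IsDiffGerm φ) (hψ : IsDiffGerm ψ) :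
    IsDiffGerm (φ ∘ ψ) := by
  have h : AnalyticAt ℂ φ (ψ 0) := by rw [hψ.2.1]; exact hφ.1
  refine ⟨h.comp hψ.1, by simp [hψ.2.1, hφ.2.1], ?_⟩
  rw [fderiv_comp _ h.differentiableAt hψ.1.differentiableAt, hψ.2.1]
  exact hφ.2.2.comp hψ.2.2

theorem IsDiffGerm.exists_inverse [CompleteSpace E] {φ : E → E} (hφ : IsDiffGerm φ) :
    ∃ ψ : E → E, IsDiffGerm ψ ∧ (∀ᶠ x in 𝓝 0, φ (ψ x) = x) ∧ ∀ᶠ x in 𝓝 0, ψ (φ x) = x := by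
  obtain ⟨ha, h0, e, he⟩ := hφ
  have hs : HasStrictFDerivAt φ (e : E →L[ℂ] E) 0 := by
    rw [he]; exact ha.hasStrictFDerivAt
  have hc : ContDiffAt ℂ ⊤ φ 0 := ha.contDiffAt
  have hinv := hs.to_localInverse
  have hleft := hs.eventually_left_inverse
  have hright := hs.eventually_right_inverse
  have ha' : ContDiffAt ℂ ⊤ (hs.localInverse φ e 0) (φ 0) :=
    hc.to_localInverse (hf' := hs.hasFDerivAt) (by simp)
  rw [h0] at hinv hright ha'
  refine ⟨hs.localInverse φ e 0, ⟨ha'.analyticAt, ?_, ?_⟩, hright, hleft⟩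
  · have := hleft.self_of_nhds
    rwa [h0] at this
  · rw [hinv.hasFDerivAt.fderiv]
    exact ⟨e.symm, rfl⟩

theorem isInvertible_iff_apply_one_ne_zero {L : ℂ →L[ℂ] ℂ} : L.IsInvertible ↔ L 1 ≠ 0 := by
  constructor
  · rintro ⟨e, rfl⟩ h
    exact one_ne_zero ((map_eq_zero_iff _ e.injective).1 h)
  · intro h
    refine ⟨ContinuousLinearEquiv.unitsEquivAut ℂ (Units.mk0 _ h), ?_⟩
    ext
    simp

theorem isDiffGerm_iff_deriv {φ : ℂ → ℂ} :
    IsDiffGerm φ ↔ AnalyticAt ℂ φ 0 ∧ φ 0 = 0 ∧ deriv φ 0 ≠ 0 := by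
  rw [IsDiffGerm, isInvertible_iff_apply_one_ne_zero, fderiv_apply_one_eq_deriv]

theorem IsDiffGerm.eventually_injective [CompleteSpace E] {φ : E → E} (hφ : IsDiffGerm φ) :
    ∀ᶠ p : E × E in 𝓝 0, φ p.1 = φ p.2 → p.1 = p.2 := by
  obtain ⟨ψ, -, -, hl⟩ := hφ.exists_inverse
  filter_upwards [(continuous_fst.tendsto (0 : E × E)).eventually hl,
    (continuous_snd.tendsto (0 : E × E)).eventually hl] with p h1 h2 h3
  rw [← h1, h3, h2]

end DiffGerm

/-! ### Second derivatives at a critical point -/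

section Hessian

variable {E E' : Type*} [NormedAddCommGroup E] [NormedSpace ℂ E] [NormedAddCommGroup E']
  [NormedSpace ℂ E']

/-- Second derivative of `f ∘ P` at a critical point of `f`. -/
theorem fderiv_fderiv_comp [CompleteSpace E] {f : E → ℂ} {P : E' → E}
    (hf : AnalyticAt ℂ f 0) (hd : fderiv ℂ f 0 = 0)
    (hP : AnalyticAt ℂ P 0) (hP0 : P 0 = 0) (v w : E') :
    fderiv ℂ (fderiv ℂ fun x => f (P x)) 0 v w
      = fderiv ℂ (fderiv ℂ f) 0 (fderiv ℂ P 0 v) (fderiv ℂ P 0 w) := by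
  have ht : Tendsto P (𝓝 0) (𝓝 0) := by
    have := hP.continuousAt.tendsto; rwa [hP0] at this
  have he : (fderiv ℂ fun x => f (P x)) =ᶠ[𝓝 0]
      fun x => (fderiv ℂ f (P x)).comp (fderiv ℂ P x) := by
    filter_upwards [ht.eventually hf.eventually_analyticAt, hP.eventually_analyticAt] with x h1 h2
    exact fderiv_comp x h1.differentiableAt h2.differentiableAt
  have hf' : HasFDerivAt (fderiv ℂ f) (fderiv ℂ (fderiv ℂ f) 0) (P 0) := by
    rw [hP0]; exact hf.fderiv.differentiableAt.hasFDerivAt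
  have h1 := hf'.comp 0 hP.differentiableAt.hasFDerivAt
  have h2 := h1.clm_comp hP.fderiv.differentiableAt.hasFDerivAt
  rw [he.fderiv_eq]
  have h3 := h2.fderiv
  simp only [Function.comp_def] at h3
  rw [h3]
  -- The term containing the second derivative of `P` is composed with the differential of `f` at
  -- `0`, which is zero.
  simp [hP0, hd]

/-- Second derivative of `u ∘ f` at a critical point of `f`. -/
theorem fderiv_fderiv_comp_left {f : E → ℂ} {u : ℂ → ℂ} (hf : AnalyticAt ℂ f 0) (hf0 : f 0 = 0)
    (hd : fderiv ℂ f 0 = 0) (hu : AnalyticAt ℂ u 0) (v w : E) :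
    fderiv ℂ (fderiv ℂ fun x => u (f x)) 0 v w
      = deriv u 0 * fderiv ℂ (fderiv ℂ f) 0 v w := by
  have ht : Tendsto f (𝓝 0) (𝓝 0) := by
    have := hf.continuousAt.tendsto; rwa [hf0] at this
  have he : (fderiv ℂ fun x => u (f x)) =ᶠ[𝓝 0] fun x => deriv u (f x) • fderiv ℂ f x := by
    filter_upwards [ht.eventually hu.eventually_analyticAt, hf.eventually_analyticAt] with x h1 h2
    exact (h1.differentiableAt.hasDerivAt.comp_hasFDerivAt x h2.differentiableAt.hasFDerivAt).fderiv
  have hu' : HasDerivAt (deriv u) (deriv (deriv u) 0) (f 0) := by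
    rw [hf0]; exact hu.deriv.differentiableAt.hasDerivAt
  have h1 := hu'.comp_hasFDerivAt 0 hf.differentiableAt.hasFDerivAt
  have h2 := h1.smul hf.fderiv.differentiableAt.hasFDerivAt
  rw [he.fderiv_eq]
  have h3 := h2.fderiv
  simp only [Function.comp_def] at h3
  refine (congrArg (fun L : E →L[ℂ] E →L[ℂ] ℂ => L v w) h3).trans ?_
  simp [hf0, hd]

theorem deriv_deriv_eq {F : ℂ → ℂ} (hF : AnalyticAt ℂ F 0) :
    deriv (deriv F) 0 = fderiv ℂ (fderiv ℂ F) 0 1 1 := by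
  have h1 : deriv F = fun t => fderiv ℂ F t 1 := by
    ext t; exact fderiv_apply_one_eq_deriv.symm
  rw [h1]
  have := (hF.fderiv.differentiableAt.hasFDerivAt (x := (0 : ℂ))).hasDerivAt
  have h2 := this.clm_apply (hasDerivAt_const (0 : ℂ) (1 : ℂ))
  rw [h2.deriv]
  simp

/-- Second derivative of the restriction of `f` to a curve through a critical point. -/
theorem deriv_deriv_comp_curve [CompleteSpace E] {f : E → ℂ} {p : ℂ → E} (hf : AnalyticAt ℂ f 0)
    (hd : fderiv ℂ f 0 = 0) (hp : AnalyticAt ℂ p 0) (hp0 : p 0 = 0) :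
    deriv (deriv fun t => f (p t)) 0 = fderiv ℂ (fderiv ℂ f) 0 (deriv p 0) (deriv p 0) := by
  have h : AnalyticAt ℂ (fun t => f (p t)) 0 := hf.comp_of_eq hp hp0
  rw [deriv_deriv_eq h, fderiv_fderiv_comp hf hd hp hp0, fderiv_apply_one_eq_deriv]

theorem deriv_comp_curve {f : E → ℂ} {p : ℂ → E} (hf : AnalyticAt ℂ f 0)
    (hd : fderiv ℂ f 0 = 0) (hp : AnalyticAt ℂ p 0) (hp0 : p 0 = 0) :
    deriv (fun t => f (p t)) 0 = 0 := by
  have h1 : HasFDerivAt f (0 : E →L[ℂ] ℂ) (p 0) := by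
    rw [hp0, ← hd]; exact hf.differentiableAt.hasFDerivAt
  exact (h1.comp_hasDerivAt (0 : ℂ) hp.differentiableAt.hasDerivAt).deriv

end Hessian

/-! ### Matching first-order jets along the axes -/

section Straighten

variable {n : ℕ}

theorem hasFDerivAt_coord (i : Fin n) (x : Cn n) :
    HasFDerivAt (fun x : Cn n => x i)
      (ContinuousLinearMap.proj (R := ℂ) (φ := fun _ : Fin n => ℂ) i) x :=
  (ContinuousLinearMap.proj (R := ℂ) (φ := fun _ : Fin n => ℂ) i).hasFDerivAt

theorem hasDerivAt_single (i : Fin n) (t : ℂ) :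
    HasDerivAt (fun t : ℂ => (Pi.single i t : Cn n)) (Pi.single i 1) t :=
  (ContinuousLinearMap.single ℂ (fun _ : Fin n => ℂ) i).hasDerivAt

theorem ext_single {L L' : Cn n →L[ℂ] ℂ} (h : ∀ i, L (Pi.single i 1) = L' (Pi.single i 1)) :
    L = L' := by
  ext x
  have hx : x = ∑ i, x i • (Pi.single i 1 : Cn n) := by
    ext j
    simp [Finset.sum_apply, Pi.single_apply]
  rw [hx]
  simp [h]

/-- The change of coordinates `x_k ↦ x_k + ∑_{j ≠ k} x_j c_{kj}(x_k)`. -/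
def straighten (c : Fin n → Fin n → ℂ → ℂ) (x : Cn n) : Cn n :=
  fun k => x k + ∑ j ∈ Finset.univ.erase k, x j * c k j (x k)

variable {c : Fin n → Fin n → ℂ → ℂ}

/-- On the `k`-th axis the correction to component `k` vanishes because the other coordinates do,
and the correction to any other component because `c` is evaluated at `0`. -/
theorem straighten_single (hc0 : ∀ k j, c k j 0 = 0) (k : Fin n) (t : ℂ) :
    straighten c (Pi.single k t) = Pi.single k t := by
  ext i
  simp only [straighten]
  rw [Finset.sum_eq_zero, add_zero]
  intro j hj
  by_cases hik : i = k
  · subst hik; simp [Finset.ne_of_mem_erase hj]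
  · simp [hik, hc0]

theorem hasFDerivAt_straighten_axis (hc : ∀ k j, AnalyticAt ℂ (c k j) 0) (k : Fin n) :
    ∀ᶠ t in 𝓝 (0 : ℂ), HasFDerivAt (fun x => straighten c x k)
      (ContinuousLinearMap.proj (R := ℂ) (φ := fun _ : Fin n => ℂ) k
        + ∑ j ∈ Finset.univ.erase k, c k j t •
          ContinuousLinearMap.proj (R := ℂ) (φ := fun _ : Fin n => ℂ) j) (Pi.single k t) := by
  filter_upwards [eventually_all.2 fun j => (hc k j).eventually_analyticAt] with t ht
  refine (hasFDerivAt_coord k _).add (HasFDerivAt.fun_sum fun j hj => ?_)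
  have h1 : HasDerivAt (c k j) (deriv (c k j) t) ((Pi.single k t : Cn n) k) := by
    rw [Pi.single_eq_same]; exact (ht j).differentiableAt.hasDerivAt
  have h2 := (hasFDerivAt_coord j (Pi.single k t)).mul
    (h1.comp_hasFDerivAt (Pi.single k t) (hasFDerivAt_coord k _))
  refine h2.congr_fderiv ?_
  ext x
  simp [Finset.ne_of_mem_erase hj]

theorem analyticAt_straighten (hc : ∀ k j, AnalyticAt ℂ (c k j) 0) :
    AnalyticAt ℂ (straighten c) 0 := by
  refine AnalyticAt.pi fun k => (analyticAt_coord k 0).add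
    (Finset.analyticAt_fun_sum _ fun j _ => (analyticAt_coord j 0).mul ?_)
  exact (hc k j).comp_of_eq (analyticAt_coord k 0) rfl

theorem isDiffGerm_straighten (hc : ∀ k j, AnalyticAt ℂ (c k j) 0) (hc0 : ∀ k j, c k j 0 = 0) :
    IsDiffGerm (straighten c) := by
  refine ⟨analyticAt_straighten hc, by ext k; simp [straighten], ?_⟩
  have : HasFDerivAt (straighten c) (.id ℂ (Cn n)) 0 := by
    rw [hasFDerivAt_pi']
    intro k
    have := (hasFDerivAt_straighten_axis hc k).self_of_nhds
    rw [Pi.single_zero] at this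
    refine this.congr_fderiv ?_
    ext x
    simp [hc0]
  rw [this.fderiv]
  exact ⟨ContinuousLinearEquiv.refl ℂ (Cn n), rfl⟩

/-- By `hfc`, the differential of `f` on the `k`-th axis is a multiple of dx_k + ∑ c_kj dx_j, which
is the differential of the `k`-th straightened coordinate. So `f` and the sum of its axis
restrictions, taken in the straightened coordinates, agree to first order on that axis; the summands
with i ≠ k contribute nothing, having a critical point at `0`. The inverse `Z` fixes the axes, so
the double vanishing survives composition with it. -/
theorem inGenIdeal_straighten (hc : ∀ k j, AnalyticAt ℂ (c k j) 0) (hc0 : ∀ k j, c k j 0 = 0)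
    {Z : Cn n → Cn n} (hZ : IsDiffGerm Z) (hYZ : ∀ᶠ x in 𝓝 0, straighten c (Z x) = x)
    (hZY : ∀ᶠ x in 𝓝 0, Z (straighten c x) = x) {f : Cn n → ℂ} (hf : AnalyticAt ℂ f 0)
    (hf0 : f 0 = 0) (hd : fderiv ℂ f 0 = 0)
    (hfc : ∀ k, ∀ᶠ t in 𝓝 (0 : ℂ), ∀ j, j ≠ k → fderiv ℂ f (Pi.single k t) (Pi.single j 1)
      = c k j t * fderiv ℂ f (Pi.single k t) (Pi.single k 1)) :
    InGenIdeal fun x => f (Z x) - ∑ k, f (Pi.single k (x k)) := by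
  have hFa : ∀ k : Fin n, AnalyticAt ℂ (fun t => f (Pi.single k t)) 0 := fun k =>
    hf.comp_of_eq (analyticAt_single k 0) (by simp)
  have hYk : ∀ k, AnalyticAt ℂ (fun x => straighten c x k) 0 := fun k =>
    (analyticAt_coord k _).comp (analyticAt_straighten hc)
  set α : Cn n → ℂ := fun x => f x - ∑ k, f (Pi.single k (straighten c x k)) with hα
  have hαa : AnalyticAt ℂ α 0 := hf.sub (Finset.analyticAt_fun_sum _ fun k _ =>
    (hFa k).comp_of_eq (hYk k) (by simp [straighten]))
  have hα0 : ∀ k (t : ℂ), α (Pi.single k t) = 0 := fun k t => by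
    simp only [hα, straighten_single hc0]
    rw [Finset.sum_eq_single k (fun i _ hi => by simp [hi, hf0]) (by simp)]
    simp
  have hα1 : ∀ k, ∀ᶠ t in 𝓝 (0 : ℂ), fderiv ℂ α (Pi.single k t) = 0 := fun k => by
    filter_upwards [hfc k, hasFDerivAt_straighten_axis hc k,
      eventually_single hf.eventually_analyticAt k, (hFa k).eventually_analyticAt,
      eventually_all.2 fun i => eventually_single (hYk i).eventually_analyticAt k]
      with t h1 h2 h3 h4 h5
    have d1 : HasDerivAt (fun t => f (Pi.single k t))
        (fderiv ℂ f (Pi.single k t) (Pi.single k 1)) t :=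
      h3.differentiableAt.hasFDerivAt.comp_hasDerivAt t (hasDerivAt_single k t)
    have d0 : ∀ i : Fin n, HasDerivAt (fun t => f (Pi.single i t)) 0 0 := fun i =>
      (hFa i).differentiableAt.hasDerivAt.congr_deriv
        (deriv_comp_curve hf hd (analyticAt_single i 0) (by simp))
    let L : Fin n → Cn n →L[ℂ] ℂ := fun i => if i = k then
      fderiv ℂ f (Pi.single k t) (Pi.single k 1) •
        (ContinuousLinearMap.proj (R := ℂ) (φ := fun _ : Fin n => ℂ) k
        + ∑ j ∈ Finset.univ.erase k, c k j t •
          ContinuousLinearMap.proj (R := ℂ) (φ := fun _ : Fin n => ℂ) j) else 0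
    have dL : ∀ i, HasFDerivAt (fun x => f (Pi.single i (straighten c x i))) (L i)
        (Pi.single k t) := fun i => by
      by_cases hik : i = k
      · subst hik
        simp only [L, if_true]
        refine HasDerivAt.comp_hasFDerivAt (f := fun x => straighten c x i)
          (h₂ := fun t => f (Pi.single i t)) _ ?_ h2
        rw [straighten_single hc0]
        simpa using d1
      · simp only [L, hik, if_false]
        have := HasDerivAt.comp_hasFDerivAt (f := fun x => straighten c x i) (Pi.single k t)
          (h₂ := fun t => f (Pi.single i t)) (h₂' := 0)
          (by rw [straighten_single hc0]; simpa [hik] using d0 i)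
          (h5 i).differentiableAt.hasFDerivAt
        exact this.congr_fderiv (by ext; simp)
    have dα : HasFDerivAt α (fderiv ℂ f (Pi.single k t) - ∑ i, L i) (Pi.single k t) :=
      h3.differentiableAt.hasFDerivAt.sub (HasFDerivAt.fun_sum fun i _ => dL i)
    rw [dα.fderiv]
    refine ext_single fun j => ?_
    rw [Finset.sum_eq_single k (by intro i _ hi; simp [L, hi]) (by simp)]
    simp only [L, if_true]
    by_cases hjk : j = k
    · subst hjk
      simp [Pi.single_apply]
    · simp [h1 j hjk, Pi.single_apply, Ne.symm hjk, mul_comm]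
  have hZax : ∀ k, ∀ᶠ t in 𝓝 (0 : ℂ), Z (Pi.single k t) = Pi.single k t := fun k => by
    filter_upwards [eventually_single hZY k] with t ht
    rwa [straighten_single hc0] at ht
  have hβ : InGenIdeal fun x => α (Z x) := by
    refine inGenIdeal_of_axes (hαa.comp_of_eq hZ.1 hZ.2.1) (fun k => ?_) (fun k => ?_) ?_
    · filter_upwards [hZax k] with t ht
      rw [ht, hα0]
    · filter_upwards [hZax k, hα1 k, eventually_single hαa.eventually_analyticAt k,
        eventually_single hZ.1.eventually_analyticAt k] with t h1 h2 h3 h4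
      rw [← h1] at h2 h3
      have := fderiv_comp (g := α) (f := Z) (Pi.single k t) h3.differentiableAt h4.differentiableAt
      rw [h2, ContinuousLinearMap.zero_comp] at this
      exact this
    · rw [hZ.2.1]
      simp [hα, straighten, hf0]
  refine hβ.congr ?_
  filter_upwards [hYZ] with x hx
  simp only [hα, hx]

/-- Proportionality of the differentials of `f` and `g` at `x`. -/
def DiffProportional (f g : Cn n → ℂ) (x : Cn n) : Prop :=
  ∀ v w, fderiv ℂ f x v * fderiv ℂ g x w = fderiv ℂ f x w * fderiv ℂ g x v

/-- Normal form of a pair of functions whose tangency curves are the axes. -/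
theorem exists_normalForm_of_axes {f g : Cn n → ℂ} (hf : AnalyticAt ℂ f 0) (hg : AnalyticAt ℂ g 0)
    (hf0 : f 0 = 0) (hg0 : g 0 = 0) (hfd : fderiv ℂ f 0 = 0) (hgd : fderiv ℂ g 0 = 0)
    (htan : ∀ k, ∀ᶠ t in 𝓝 (0 : ℂ), DiffProportional f g (Pi.single k t))
    (hdiag : ∀ i j, i ≠ j → hessian f (Pi.single i 1) (Pi.single j 1) = 0)
    (hne : ∀ i, hessian f (Pi.single i 1) (Pi.single i 1) ≠ 0)
    (hgen : ∀ i j, i ≠ j → hessian f (Pi.single i 1) (Pi.single i 1) *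
      hessian g (Pi.single j 1) (Pi.single j 1) - hessian f (Pi.single j 1) (Pi.single j 1) *
      hessian g (Pi.single i 1) (Pi.single i 1) ≠ 0) :
    ∃ Φ : Cn n → Cn n, IsDiffGerm Φ ∧ ∀ᶠ x in 𝓝 0,
      f x = ∑ k, f (Pi.single k (Φ x k)) ∧ g x = ∑ k, g (Pi.single k (Φ x k)) := by
  have hN : ∀ k j : Fin n,
      AnalyticAt ℂ (fun t : ℂ => fderiv ℂ f (Pi.single k t) (Pi.single j 1)) 0 :=
    fun k j => (analyticAt_fderiv_apply hf (Pi.single j 1)).comp_of_eq (analyticAt_single k 0)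
      (by simp)
  have hNd : ∀ k j : Fin n, deriv (fun t : ℂ => fderiv ℂ f (Pi.single k t) (Pi.single j 1)) 0
      = hessian f (Pi.single k 1) (Pi.single j 1) := fun k j => by
    have h1 : HasFDerivAt (fderiv ℂ f) (fderiv ℂ (fderiv ℂ f) 0) (Pi.single k (0 : ℂ)) := by
      rw [Pi.single_zero]; exact hf.fderiv.differentiableAt.hasFDerivAt
    have h2 := (h1.comp_hasDerivAt (0 : ℂ) (hasDerivAt_single k 0)).clm_apply
      (hasDerivAt_const (0 : ℂ) (Pi.single j 1 : Cn n))
    rw [hessian, ← add_zero (fderiv ℂ (fderiv ℂ f) 0 _ _)]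
    simpa using h2.deriv
  let N : Fin n → Fin n → ℂ → ℂ := fun k j t => fderiv ℂ f (Pi.single k t) (Pi.single j 1)
  have hN0 : ∀ k j, N k j 0 = 0 := fun k j => by simp [N, hfd]
  -- The ratio of two partial derivatives along the `k`-th axis. Both vanish at `0`, so the ratio is
  -- taken after dividing each by `t`. The denominator starts with a diagonal Hessian entry, which
  -- is nonzero, and the numerator with an off-diagonal one, which is zero.
  let c : Fin n → Fin n → ℂ → ℂ := fun k j => if j = k then fun _ => 0 else
    fun t => dslope (N k j) 0 t / dslope (N k k) 0 t
  have hden0 : ∀ k, dslope (N k k) 0 0 ≠ 0 := fun k => by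
    rw [dslope_same]
    exact (hNd k k).symm ▸ hne k
  have hc : ∀ k j, AnalyticAt ℂ (c k j) 0 := fun k j => by
    by_cases hjk : j = k
    · simpa [c, hjk] using analyticAt_const
    · simp only [c, hjk, if_false]
      exact (analyticAt_dslope (hN k j)).div (analyticAt_dslope (hN k k)) (hden0 k)
  have hc0 : ∀ k j, c k j 0 = 0 := fun k j => by
    by_cases hjk : j = k
    · simp [c, hjk]
    · simp only [c, hjk, if_false, dslope_same]
      rw [show deriv (N k j) 0 = 0 from (hNd k j).trans (hdiag k j (Ne.symm hjk)), zero_div]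
  have hden : ∀ k, ∀ᶠ t in 𝓝 (0 : ℂ), dslope (N k k) 0 t ≠ 0 := fun k =>
    (analyticAt_dslope (hN k k)).continuousAt.eventually_ne (hden0 k)
  have hfc : ∀ k, ∀ᶠ t in 𝓝 (0 : ℂ), ∀ j, j ≠ k → N k j t = c k j t * N k k t := fun k => by
    filter_upwards [hden k] with t ht j hj
    rw [eq_add_mul_dslope (N k j) t, eq_add_mul_dslope (N k k) t, hN0, hN0]
    simp only [c, hj, if_false]
    field_simp
    ring
  -- Tangency along the axis gives `g` the same ratios as `f`; this is why one straightening serves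
  -- both functions.
  have hgc : ∀ k, ∀ᶠ t in 𝓝 (0 : ℂ), ∀ j, j ≠ k →
      fderiv ℂ g (Pi.single k t) (Pi.single j 1)
        = c k j t * fderiv ℂ g (Pi.single k t) (Pi.single k 1) := fun k => by
    filter_upwards [hden k, hfc k, htan k] with t h1 h2 h3 j hj
    by_cases ht : t = 0
    · simp [ht, hgd]
    · have h4 := h3 (Pi.single j 1) (Pi.single k 1)
      have h5 := h2 j hj
      have h6 : N k k t ≠ 0 := by
        rw [eq_add_mul_dslope (N k k) t, hN0, zero_add]
        exact mul_ne_zero ht h1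
      change N k j t * _ = N k k t * _ at h4
      rw [h5] at h4
      apply mul_left_cancel₀ h6
      rw [← h4]; ring
  have hY := isDiffGerm_straighten hc hc0
  obtain ⟨Z, hZ, hYZ, hZY⟩ := hY.exists_inverse
  have hFa : ∀ {f : Cn n → ℂ}, AnalyticAt ℂ f 0 → ∀ k : Fin n,
      AnalyticAt ℂ (fun t => f (Pi.single k t)) 0 := fun hf k =>
    hf.comp_of_eq (analyticAt_single k 0) (by simp)
  have hF2 : ∀ {f : Cn n → ℂ}, AnalyticAt ℂ f 0 → fderiv ℂ f 0 = 0 → ∀ k : Fin n,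
      deriv (deriv fun t => f (Pi.single k t)) 0 = hessian f (Pi.single k 1) (Pi.single k 1) :=
    fun hf hd k => by
      rw [deriv_deriv_comp_curve hf hd (analyticAt_single k 0) (by simp),
        (hasDerivAt_single k 0).deriv, hessian]
  obtain ⟨φ, hφ, hφe⟩ := exists_diffGerm_of_inGenIdeal (hFa hf) (hFa hg)
    (fun k => deriv_comp_curve hf hfd (analyticAt_single k 0) (by simp))
    (fun k => deriv_comp_curve hg hgd (analyticAt_single k 0) (by simp))
    (fun i j hij => by
      rw [hF2 hf hfd, hF2 hf hfd, hF2 hg hgd, hF2 hg hgd]; exact hgen i j hij)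
    (inGenIdeal_straighten hc hc0 hZ hYZ hZY hf hf0 hfd hfc)
    (inGenIdeal_straighten hc hc0 hZ hYZ hZY hg hg0 hgd hgc)
  refine ⟨φ ∘ straighten c, hφ.comp hY, ?_⟩
  filter_upwards [hY.tendsto.eventually hφe, hZY] with x h1 h2
  rw [h2] at h1
  exact h1

end Straighten

/-! ### From tangency curves to axes -/

section Frame

variable {n : ℕ}

/-- The relation is bilinear, so basis vectors suffice. The coordinate-free form is the one that
transports under changes of coordinates. -/
theorem mem_tang_iff {f g : Cn n → ℂ} {x : Cn n} : x ∈ tang f g ↔ DiffProportional f g x := by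
  constructor
  · intro h
    have h1 : ∀ j, fderiv ℂ g x (Pi.single j 1) • fderiv ℂ f x
        = fderiv ℂ f x (Pi.single j 1) • fderiv ℂ g x := fun j => ext_single fun i => by
      have := h i j
      simp only [smul_apply, smul_eq_mul]
      linear_combination this
    intro v w
    have h2 : fderiv ℂ f x v • fderiv ℂ g x = fderiv ℂ g x v • fderiv ℂ f x :=
      ext_single fun j => by
        have := DFunLike.congr_fun (h1 j) v
        simp only [smul_apply, smul_eq_mul] at this ⊢
        linear_combination this
    have := DFunLike.congr_fun h2 w
    simp only [smul_apply, smul_eq_mul] at this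
    linear_combination this
  · intro h i j
    rw [h, sub_self]

theorem DiffProportional.comp {f g : Cn n → ℂ} {P : Cn n → Cn n} {x : Cn n}
    (h : DiffProportional f g (P x)) (hf : AnalyticAt ℂ f (P x)) (hg : AnalyticAt ℂ g (P x))
    (hP : AnalyticAt ℂ P x) : DiffProportional (fun y => f (P y)) (fun y => g (P y)) x := by
  intro v w
  have h1 := fderiv_comp (g := f) x hf.differentiableAt hP.differentiableAt
  have h2 := fderiv_comp (g := g) x hg.differentiableAt hP.differentiableAt
  simp only [Function.comp_def] at h1 h2
  rw [h1, h2]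
  exact h _ _

/-- `v` is a basis diagonalizing the Hessians of `f` and `g`, with distinct ratios of diagonal
entries. -/
structure IsDiagonalFrame (f g : Cn n → ℂ) (v : Fin n → Cn n) : Prop where
  linearIndependent : LinearIndependent ℂ v
  diag : ∀ i j, i ≠ j → hessian f (v i) (v j) = 0
  ne : ∀ i, hessian f (v i) (v i) ≠ 0
  ne_right : ∀ i, hessian g (v i) (v i) ≠ 0
  gen : ∀ i j, i ≠ j → hessian f (v i) (v i) * hessian g (v j) (v j)
    - hessian f (v j) (v j) * hessian g (v i) (v i) ≠ 0

theorem IsDiagonalFrame.smul {f g : Cn n → ℂ} {v : Fin n → Cn n} (h : IsDiagonalFrame f g v)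
    {c : Fin n → ℂ} (hc : ∀ k, c k ≠ 0) : IsDiagonalFrame f g fun k => c k • v k where
  linearIndependent := h.linearIndependent.units_smul fun k => Units.mk0 (c k) (hc k)
  diag i j hij := by
    have := h.diag i j hij
    simp only [hessian] at this
    simp [hessian, this]
  ne i := by
    have := h.ne i
    simp only [hessian] at this
    simp [hessian, this, hc]
  ne_right i := by
    have := h.ne_right i
    simp only [hessian] at this
    simp [hessian, this, hc]
  gen i j hij := by
    have := mul_ne_zero (mul_ne_zero (pow_ne_zero 2 (hc i)) (pow_ne_zero 2 (hc j))) (h.gen i j hij)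
    simp only [hessian, map_smul, smul_apply, smul_eq_mul] at this ⊢
    convert this using 1
    ring

theorem IsDiagonalFrame.comp_left {f g : Cn n → ℂ} {v : Fin n → Cn n}
    (h : IsDiagonalFrame f g v) (hf : IsMorse f) (hg : IsMorse g) {a b : ℂ → ℂ}
    (ha : IsDiffGerm a) (hb : IsDiffGerm b) :
    IsDiagonalFrame (fun x => a (f x)) (fun x => b (g x)) v := by
  have ha' := (isDiffGerm_iff_deriv.1 ha).2.2
  have hb' := (isDiffGerm_iff_deriv.1 hb).2.2
  have h1 : ∀ v w, hessian (fun x => a (f x)) v w = deriv a 0 * hessian f v w := fun v w =>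
    fderiv_fderiv_comp_left hf.analyticAt hf.map_zero hf.critical ha.1 v w
  have h2 : ∀ v w, hessian (fun x => b (g x)) v w = deriv b 0 * hessian g v w := fun v w =>
    fderiv_fderiv_comp_left hg.analyticAt hg.map_zero hg.critical hb.1 v w
  refine ⟨h.linearIndependent, fun i j hij => ?_, fun i => ?_, fun i => ?_,
    fun i j hij => ?_⟩
  · rw [h1, h.diag i j hij, mul_zero]
  · rw [h1]; exact mul_ne_zero ha' (h.ne i)
  · rw [h2]; exact mul_ne_zero hb' (h.ne_right i)
  · rw [h1, h1, h2, h2]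
    have := mul_ne_zero (mul_ne_zero ha' hb') (h.gen i j hij)
    convert this using 1
    ring

/-- Normal form of a pair of functions, in terms of its restrictions to the tangency curves. -/
theorem exists_normalForm {f g : Cn n → ℂ} (hf : AnalyticAt ℂ f 0) (hg : AnalyticAt ℂ g 0)
    (hf0 : f 0 = 0) (hg0 : g 0 = 0) (hfd : fderiv ℂ f 0 = 0) (hgd : fderiv ℂ g 0 = 0)
    {p : Fin n → ℂ → Cn n} (hp : ∀ k, AnalyticAt ℂ (p k) 0) (hp0 : ∀ k, p k 0 = 0)
    (htan : ∀ k, ∀ᶠ t in 𝓝 (0 : ℂ), DiffProportional f g (p k t))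
    (hframe : IsDiagonalFrame f g fun k => deriv (p k) 0) :
    ∃ Φ : Cn n → Cn n, IsDiffGerm Φ ∧ ∀ᶠ x in 𝓝 0,
      f x = ∑ k, f (p k (Φ x k)) ∧ g x = ∑ k, g (p k (Φ x k)) := by
  -- `P` sends the `k`-th axis to the `k`-th curve. Its derivative sends the standard basis to the
  -- tangent vectors, which are independent.
  let P : Cn n → Cn n := fun y => ∑ k, p k (y k)
  have hPk : ∀ k, AnalyticAt ℂ (fun y : Cn n => p k (y k)) 0 := fun k =>
    (hp k).comp_of_eq (analyticAt_coord k 0) rfl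
  have hPa : AnalyticAt ℂ P 0 := Finset.analyticAt_fun_sum _ fun k _ => hPk k
  have hP0 : P 0 = 0 := by simp [P, hp0]
  have hPs : ∀ k (t : ℂ), P (Pi.single k t) = p k t := fun k t => by
    simp only [P]
    rw [Finset.sum_eq_single k (fun i _ hi => by simp [hi, hp0]) (by simp)]
    simp
  have hPd : ∀ k, fderiv ℂ P 0 (Pi.single k 1) = deriv (p k) 0 := fun k => by
    have h1 : HasFDerivAt P (fderiv ℂ P 0) (Pi.single k (0 : ℂ)) := by
      rw [Pi.single_zero]; exact hPa.differentiableAt.hasFDerivAt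
    have h2 := (h1.comp_hasDerivAt (0 : ℂ) (hasDerivAt_single k 0)).deriv
    rw [← h2]
    congr 1
    ext1 t
    exact hPs k t
  have hPinv : (fderiv ℂ P 0).IsInvertible := by
    have hinj : Function.Injective (fderiv ℂ P 0 : Cn n →ₗ[ℂ] Cn n) := by
      rw [← LinearMap.ker_eq_bot, LinearMap.ker_eq_bot']
      intro y hy
      have hy' : y = ∑ k, y k • (Pi.single k 1 : Cn n) := by
        ext j
        simp [Finset.sum_apply, Pi.single_apply]
      rw [hy', map_sum] at hy
      simp only [map_smul, ContinuousLinearMap.coe_coe, hPd] at hy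
      ext k
      exact Fintype.linearIndependent_iff.1 hframe.linearIndependent y hy k
    refine ⟨(LinearEquiv.ofInjectiveEndo _ hinj).toContinuousLinearEquiv, ?_⟩
    ext1 x
    rfl
  have hPg : IsDiffGerm P := ⟨hPa, hP0, hPinv⟩
  have hH : ∀ {f : Cn n → ℂ}, AnalyticAt ℂ f 0 → fderiv ℂ f 0 = 0 → ∀ i j : Fin n,
      hessian (fun y => f (P y)) (Pi.single i 1) (Pi.single j 1)
        = hessian f (deriv (p i) 0) (deriv (p j) 0) := fun hf hd i j => by
    rw [hessian, fderiv_fderiv_comp hf hd hPa hP0, hPd, hPd, hessian]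
  have hcrit : ∀ {f : Cn n → ℂ}, AnalyticAt ℂ f 0 → fderiv ℂ f 0 = 0 →
      fderiv ℂ (fun y => f (P y)) 0 = 0 := fun {f} hf hd => by
    have := fderiv_comp (g := f) (f := P) 0 (by rw [hP0]; exact hf.differentiableAt)
      hPa.differentiableAt
    rw [hP0, hd, ContinuousLinearMap.zero_comp] at this
    exact this
  obtain ⟨Φ, hΦ, hΦe⟩ := exists_normalForm_of_axes (f := fun y => f (P y)) (g := fun y => g (P y))
    (hf.comp_of_eq hPa hP0) (hg.comp_of_eq hPa hP0) (by simp [hP0, hf0]) (by simp [hP0, hg0])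
    (hcrit hf hfd) (hcrit hg hgd)
    (fun k => by
      filter_upwards [htan k, eventually_single hPa.eventually_analyticAt k,
        eventually_single (hPg.tendsto.eventually hf.eventually_analyticAt) k,
        eventually_single (hPg.tendsto.eventually hg.eventually_analyticAt) k] with t h1 h2 h3 h4
      exact DiffProportional.comp (by rw [hPs]; exact h1) h3 h4 h2)
    (fun i j hij => by rw [hH hf hfd]; exact hframe.diag i j hij)
    (fun i => by rw [hH hf hfd]; exact hframe.ne i)
    (fun i j hij => by rw [hH hf hfd, hH hf hfd, hH hg hgd, hH hg hgd]; exact hframe.gen i j hij)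
  obtain ⟨Q, hQ, hPQ, -⟩ := hPg.exists_inverse
  refine ⟨Φ ∘ Q, hΦ.comp hQ, ?_⟩
  filter_upwards [hPQ, hQ.tendsto.eventually hΦe] with x h1 h2
  simp only [h1, hPs] at h2
  exact h2

end Frame

/-! ### Tangents of the tangency curves -/

section TangentDirections

variable {n : ℕ}

theorem hessian_symm {f : Cn n → ℂ} (hf : AnalyticAt ℂ f 0) (v w : Cn n) :
    hessian f v w = hessian f w v := by
  have : ContDiffAt ℂ ⊤ f 0 := hf.contDiffAt
  exact (this.isSymmSndFDerivAt (by simp)) v w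

/-- Polarization of the quadratic part. -/
theorem hessian_of_quadPart {f : Cn n → ℂ} (hf : AnalyticAt ℂ f 0) {A : Cn n ≃ₗ[ℂ] Cn n}
    {μ : Fin n → ℂ} (h : ∀ x, quadPart f (A x) = ∑ i, μ i * x i ^ 2) (x : Cn n) (j : Fin n) :
    hessian f (A x) (A (Pi.single j 1)) = 2 * (μ j * x j) := by
  have h1 : ∀ x, hessian f (A x) (A x) = 2 * ∑ i, μ i * x i ^ 2 := fun x => by
    rw [← h, quadPart]; ring
  have h2 : hessian f (A (x + Pi.single j 1)) (A (x + Pi.single j 1))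
      = hessian f (A x) (A x) + 2 * hessian f (A x) (A (Pi.single j 1))
        + hessian f (A (Pi.single j 1)) (A (Pi.single j 1)) := by
    have h3 := hessian_symm hf (A x) (A (Pi.single j 1))
    simp only [hessian] at h3 ⊢
    simp only [map_add, add_apply]
    rw [h3]; ring
  rw [h1, h1, h1] at h2
  have h4 : ∑ i, μ i * (x + Pi.single j 1 : Cn n) i ^ 2
      = ∑ i, μ i * x i ^ 2 + 2 * (μ j * x j) + ∑ i, μ i * (Pi.single j 1 : Cn n) i ^ 2 := by
    have : 2 * (μ j * x j) = ∑ i, 2 * (μ i * x i) * (Pi.single j 1 : Cn n) i := by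
      rw [Finset.sum_eq_single j (fun i _ hi => by simp [hi]) (by simp)]
      simp
    rw [this, ← Finset.sum_add_distrib, ← Finset.sum_add_distrib]
    refine Finset.sum_congr rfl fun i _ => ?_
    simp only [Pi.add_apply]; ring
  rw [h4] at h2
  linear_combination (-1 / 2 : ℂ) * h2

/-- Since the differential vanishes at `0`, it can be divided by `t` along the curve; the quotient
at `0` is its derivative there, which is the Hessian in the tangent direction. -/
theorem exists_eq_smul_along_curve {f : Cn n → ℂ} (hf : AnalyticAt ℂ f 0) (hd : fderiv ℂ f 0 = 0)
    {p : ℂ → Cn n} (hp : AnalyticAt ℂ p 0) (hp0 : p 0 = 0) (v : Cn n) :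
    ∃ a : ℂ → ℂ, ContinuousAt a 0 ∧ a 0 = hessian f (deriv p 0) v ∧
      ∀ t, fderiv ℂ f (p t) v = t * a t := by
  have h1 : AnalyticAt ℂ (fun t => fderiv ℂ f (p t) v) 0 :=
    (analyticAt_fderiv_apply hf v).comp_of_eq hp hp0
  refine ⟨_, (analyticAt_dslope h1).continuousAt, ?_, fun t => ?_⟩
  · rw [dslope_same]
    have h1 : HasFDerivAt (fderiv ℂ f) (fderiv ℂ (fderiv ℂ f) 0) (p 0) := by
      rw [hp0]; exact hf.fderiv.differentiableAt.hasFDerivAt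
    have h2 := (h1.comp_hasDerivAt (0 : ℂ) hp.differentiableAt.hasDerivAt).clm_apply
      (hasDerivAt_const (0 : ℂ) v)
    rw [hessian, ← add_zero (fderiv ℂ (fderiv ℂ f) 0 _ _)]
    simpa using h2.deriv
  · have := eq_add_mul_dslope (fun t => fderiv ℂ f (p t) v) t
    simpa [hp0, hd] using this

/-- The differentials of the quadratic parts are proportional in the direction of a tangency
curve. -/
theorem hessian_proportional {f g : Cn n → ℂ} (hf : AnalyticAt ℂ f 0) (hg : AnalyticAt ℂ g 0)
    (hfd : fderiv ℂ f 0 = 0) (hgd : fderiv ℂ g 0 = 0) {p : ℂ → Cn n} (hp : AnalyticAt ℂ p 0)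
    (hp0 : p 0 = 0) (htan : ∀ᶠ t in 𝓝 (0 : ℂ), DiffProportional f g (p t)) (v w : Cn n) :
    hessian f (deriv p 0) v * hessian g (deriv p 0) w
      = hessian f (deriv p 0) w * hessian g (deriv p 0) v := by
  obtain ⟨a, ha, ha0, hae⟩ := exists_eq_smul_along_curve hf hfd hp hp0 v
  obtain ⟨a', ha', ha0', hae'⟩ := exists_eq_smul_along_curve hf hfd hp hp0 w
  obtain ⟨b, hb, hb0, hbe⟩ := exists_eq_smul_along_curve hg hgd hp hp0 v
  obtain ⟨b', hb', hb0', hbe'⟩ := exists_eq_smul_along_curve hg hgd hp hp0 w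
  have hc : ContinuousAt (fun t => a t * b' t - a' t * b t) 0 := (ha.mul hb').sub (ha'.mul hb)
  have h1 : ∀ᶠ t in 𝓝 (0 : ℂ), a t * b' t - a' t * b t = 0 := by
    -- Each differential carries a factor `t`, so the tangency relation carries t²; it is divided
    -- out one factor at a time.
    refine eventually_eq_zero_of_mul hc (eventually_eq_zero_of_mul (continuousAt_id.mul hc) ?_)
    filter_upwards [htan] with t ht
    have := ht v w
    rw [hae, hae', hbe, hbe'] at this
    change t * (t * (a t * b' t - a' t * b t)) = 0
    linear_combination this
  have := h1.self_of_nhds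
  rw [ha0, ha0', hb0, hb0'] at this
  exact sub_eq_zero.1 this

/-- The tangent of a tangency curve is one of the common axes of the quadratic parts. -/
theorem exists_direction {f g : Cn n → ℂ} (hf : IsMorse f) (hg : IsMorse g)
    {A : Cn n ≃ₗ[ℂ] Cn n} {μ : Fin n → ℂ} (hμ : Function.Injective μ)
    (hqf : ∀ x, quadPart f (A x) = ∑ i, x i ^ 2) (hqg : ∀ x, quadPart g (A x) = ∑ i, μ i * x i ^ 2)
    {p : ℂ → Cn n} (hp : AnalyticAt ℂ p 0) (hp0 : p 0 = 0) (hpd : deriv p 0 ≠ 0)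
    (htan : ∀ᶠ t in 𝓝 (0 : ℂ), DiffProportional f g (p t)) :
    ∃ (i : Fin n) (c : ℂ), c ≠ 0 ∧ deriv p 0 = c • A (Pi.single i 1) := by
  set u : Cn n := A.symm (deriv p 0) with hu
  have hAu : A u = deriv p 0 := by simp [hu]
  have hF := fun j => hessian_of_quadPart hf.analyticAt (μ := fun _ => 1) (by simpa using hqf) u j
  have hG := fun j => hessian_of_quadPart hg.analyticAt hqg u j
  -- In diagonal coordinates proportionality reads u_a u_b (μ_b - μ_a) = 0, so the tangent has a
  -- single nonzero coordinate.
  have h1 : ∀ a b, a ≠ b → u a * u b = 0 := fun a b hab => by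
    have := hessian_proportional hf.analyticAt hg.analyticAt hf.critical hg.critical hp hp0 htan
      (A (Pi.single a 1)) (A (Pi.single b 1))
    rw [← hAu, hF, hF, hG, hG] at this
    have h2 : u a * u b * (μ b - μ a) = 0 := by linear_combination this / 4
    exact (mul_eq_zero.1 h2).resolve_right (sub_ne_zero.2 fun h => hab (hμ h).symm)
  have hu0 : u ≠ 0 := by
    intro h
    rw [h, map_zero] at hAu
    exact hpd hAu.symm
  obtain ⟨i, hi⟩ := Function.ne_iff.1 hu0
  refine ⟨i, u i, hi, ?_⟩
  rw [← hAu, ← map_smul]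
  congr 1
  ext j
  by_cases hj : j = i
  · subst hj; simp
  · simpa [hj] using (mul_eq_zero.1 (h1 i j (Ne.symm hj))).resolve_left hi

end TangentDirections

/-! ### Uniqueness of the tangency curve with a given tangent -/

section Uniqueness

variable {n : ℕ}

/-- A curve tangent to the `i`-th axis, parametrized by its `i`-th coordinate. -/
theorem exists_param_by_coord {p : ℂ → Cn n} (hp : AnalyticAt ℂ p 0) (hp0 : p 0 = 0) {i : Fin n}
    {c : ℂ} (hc : c ≠ 0) (hpd : deriv p 0 = c • (Pi.single i 1 : Cn n)) :
    ∃ (τ σ : ℂ → ℂ) (u : ℂ → Cn n), IsDiffGerm τ ∧ IsDiffGerm σ ∧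
      (∀ᶠ t in 𝓝 0, σ (τ t) = t) ∧ ContinuousAt u 0 ∧ u 0 = 0 ∧ (∀ᶠ s in 𝓝 0, u s i = 0) ∧
      ∀ s, p (σ s) = s • (Pi.single i 1 + u s) := by
  have hτd : HasDerivAt (fun t => p t i) c 0 := by
    have := hasDerivAt_pi.1 hp.differentiableAt.hasDerivAt i
    rwa [hpd, Pi.smul_apply, Pi.single_eq_same, smul_eq_mul, mul_one] at this
  have hτ : IsDiffGerm fun t => p t i :=
    isDiffGerm_iff_deriv.2 ⟨(analyticAt_coord i _).comp hp, by simp [hp0], by rwa [hτd.deriv]⟩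
  obtain ⟨σ, hσ, hτσ, hστ⟩ := hτ.exists_inverse
  have hPa : AnalyticAt ℂ (fun s => p (σ s)) 0 := hp.comp_of_eq hσ.1 hσ.2.1
  have hσd := hσ.1.differentiableAt.hasDerivAt
  have hP' : HasDerivAt (fun s => p (σ s)) (deriv σ 0 • c • (Pi.single i 1 : Cn n)) 0 := by
    have : HasDerivAt p (c • (Pi.single i 1 : Cn n)) (σ 0) := by
      rw [hσ.2.1, ← hpd]; exact hp.differentiableAt.hasDerivAt
    exact this.scomp (0 : ℂ) hσd
  have hcσ : deriv σ 0 * c = 1 := by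
    have h1 := hasDerivAt_pi.1 hP' i
    have h2 : HasDerivAt (fun s => p (σ s) i) 1 0 :=
      (hasDerivAt_id (0 : ℂ)).congr_of_eventuallyEq hτσ
    simpa using h1.unique h2
  rw [smul_smul, hcσ, one_smul] at hP'
  have hcont : ContinuousAt (dslope (fun s => p (σ s)) 0) 0 :=
    continuousAt_dslope_same.2 hPa.differentiableAt
  have hPs : ∀ s, p (σ s) = s • dslope (fun s => p (σ s)) 0 s := fun s => by
    have := sub_smul_dslope (fun s => p (σ s)) 0 s
    simpa [hσ.2.1, hp0] using this.symm
  have hucont : ContinuousAt (fun s => dslope (fun s => p (σ s)) 0 s - Pi.single i 1) 0 :=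
    hcont.sub continuousAt_const
  refine ⟨_, σ, _, hτ, hσ, hστ, hucont, ?_, ?_, fun s => ?_⟩
  · rw [dslope_same, hP'.deriv, sub_self]
  -- In this parameter the `i`-th coordinate of the curve is `s` itself, leaving no room for `u` in
  -- that slot.
  · refine eventually_eq_zero_of_mul ((continuous_apply i).continuousAt.comp hucont) ?_
    filter_upwards [hτσ] with s hs
    have := congrFun (hPs s) i
    rw [hs, Pi.smul_apply, smul_eq_mul] at this
    simp only [Pi.sub_apply, Pi.single_eq_same]
    rw [mul_sub, ← this]; ring
  · rw [add_sub_cancel, ← hPs]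

/-- The differential of a function at `t (e_i + u)`, divided by `t`. -/
theorem exists_blowup_fderiv {f : Cn n → ℂ} (hf : AnalyticAt ℂ f 0) (hd : fderiv ℂ f 0 = 0)
    (v e : Cn n) :
    ∃ k : Cn n × ℂ → ℂ, AnalyticAt ℂ k 0 ∧
      (∀ᶠ z in 𝓝 0, fderiv ℂ f (z.2 • (e + z.1)) v = z.2 * k z) ∧
      ∀ᶠ u in 𝓝 0, k (u, 0) = hessian f (e + u) v := by
  have hin : AnalyticAt ℂ (fun z : Cn n × ℂ => z.2 • (e + z.1)) 0 := by fun_prop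
  obtain ⟨k, hk, hke⟩ := exists_eq_add_mul (h := fun z : Cn n × ℂ => fderiv ℂ f (z.2 • (e + z.1)) v)
    ((analyticAt_fderiv_apply hf v).comp_of_eq hin (by simp))
  have hke' : ∀ᶠ z : Cn n × ℂ in 𝓝 0, fderiv ℂ f (z.2 • (e + z.1)) v = z.2 * k z := by
    filter_upwards [hke] with z hz
    simpa [hd] using hz
  refine ⟨k, hk, hke', ?_⟩
  have hleft : Tendsto (fun u : Cn n => (u, (0 : ℂ))) (𝓝 0) (𝓝 0) := by
    have : Continuous fun u : Cn n => (u, (0 : ℂ)) := by fun_prop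
    exact this.tendsto' _ _ rfl
  filter_upwards [hleft.eventually hke'.eventually_nhds,
    hleft.eventually hk.eventually_analyticAt] with u h1 h2
  have hline : ∀ t, HasDerivAt (fun t : ℂ => t • (e + u)) (e + u) t := fun t => by
    simpa using (hasDerivAt_id t).smul_const (e + u)
  -- The value of the quotient at `t = 0` is found along the line through `e + u`, where it must
  -- agree with the Hessian limit.
  obtain ⟨a, ha, ha0, hae⟩ := exists_eq_smul_along_curve hf hd (p := fun t : ℂ => t • (e + u))
    (by fun_prop) (by simp) v
  rw [(hline 0).deriv] at ha0
  have hpath : ContinuousAt (fun t : ℂ => (u, t)) 0 := by fun_prop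
  have hc : ContinuousAt (fun t => a t - k (u, t)) 0 :=
    ha.sub (ContinuousAt.comp (f := fun t : ℂ => (u, t)) h2.continuousAt hpath)
  have := (eventually_eq_zero_of_mul hc (by
    filter_upwards [hpath.tendsto.eventually h1] with t ht
    rw [mul_sub, ← ht, hae, sub_self])).self_of_nhds
  rw [← ha0]
  exact (sub_eq_zero.1 this).symm

/-- Two tangency curves with the same tangent coincide. -/
theorem exists_reparam_of_direction {f g : Cn n → ℂ} (hf : AnalyticAt ℂ f 0)
    (hg : AnalyticAt ℂ g 0) (hfd : fderiv ℂ f 0 = 0) (hgd : fderiv ℂ g 0 = 0) {μ : Fin n → ℂ}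
    (hμ : Function.Injective μ) (hF : ∀ x j, hessian f x (Pi.single j 1) = 2 * x j)
    (hG : ∀ x j, hessian g x (Pi.single j 1) = 2 * (μ j * x j)) {p q : ℂ → Cn n}
    (hp : AnalyticAt ℂ p 0) (hq : AnalyticAt ℂ q 0) (hp0 : p 0 = 0) (hq0 : q 0 = 0) {i : Fin n}
    {c d : ℂ} (hc : c ≠ 0) (hd : d ≠ 0) (hpd : deriv p 0 = c • (Pi.single i 1 : Cn n))
    (hqd : deriv q 0 = d • (Pi.single i 1 : Cn n))
    (hpt : ∀ᶠ t in 𝓝 (0 : ℂ), DiffProportional f g (p t))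
    (hqt : ∀ᶠ t in 𝓝 (0 : ℂ), DiffProportional f g (q t)) :
    ∃ h : ℂ → ℂ, IsDiffGerm h ∧ ∀ᶠ t in 𝓝 0, p t = q (h t) := by
  choose kf hkf hkfe hkf0 using fun j : Fin n =>
    exists_blowup_fderiv hf hfd (Pi.single j 1) (Pi.single i 1)
  choose kg hkg hkge hkg0 using fun j : Fin n =>
    exists_blowup_fderiv hg hgd (Pi.single j 1) (Pi.single i 1)
  -- Writing a curve as s (e_i + u), the tangency equations for the index pairs (i, j) are divisible
  -- by s². The quotients, together with the normalization u_i = 0, are n equations for the n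
  -- unknowns `u` that still make sense at `s = 0`.
  let K : ℂ × Cn n → Cn n := fun z j => if j = i then z.2 i else
    kf i (z.2, z.1) * kg j (z.2, z.1) - kf j (z.2, z.1) * kg i (z.2, z.1)
  have hswap : AnalyticAt ℂ (fun z : ℂ × Cn n => (z.2, z.1)) 0 := analyticAt_snd.prod analyticAt_fst
  have hKa : AnalyticAt ℂ K 0 := by
    refine AnalyticAt.pi fun j => ?_
    by_cases hj : j = i
    · simp only [hj, if_true]
      fun_prop
    · simp only [hj, if_false]
      have h1 : ∀ {k : Cn n × ℂ → ℂ}, AnalyticAt ℂ k 0 →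
        AnalyticAt ℂ (fun z : ℂ × Cn n => k (z.2, z.1)) 0 := fun hk => hk.comp_of_eq hswap rfl
      exact ((h1 (hkf i)).mul (h1 (hkg j))).sub ((h1 (hkf j)).mul (h1 (hkg i)))
  -- The linearization in `u` at the origin: diagonal, with nonzero entries because the μ_j are
  -- distinct. The implicit function theorem then allows one solution `ψ`, which both curves must
  -- follow.
  let D : Cn n →L[ℂ] Cn n := ContinuousLinearMap.pi fun j =>
    (if j = i then 1 else 4 * (μ j - μ i)) • ContinuousLinearMap.proj j
  have hK0 : ∀ᶠ u : Cn n in 𝓝 0, K (0, u)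
      = fun j => if j = i then u i else (4 * (μ j - μ i)) * ((1 + u i) * u j) := by
    filter_upwards [eventually_all.2 hkf0, eventually_all.2 hkg0] with u h1 h2
    ext j
    by_cases hj : j = i
    · simp [K, hj]
    · simp only [K, hj, if_false, h1, h2, hF, hG]
      simp [hj]
      ring
  have hK00 : K 0 = 0 := by
    have := hK0.self_of_nhds
    refine this.trans ?_
    ext j
    simp
  have hDinj : Function.Injective (D : Cn n →ₗ[ℂ] Cn n) := by
    rw [← LinearMap.ker_eq_bot, LinearMap.ker_eq_bot']
    intro x hx
    ext j
    have := congrFun hx j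
    by_cases hj : j = i
    · simpa [D, hj] using this
    · have h4 : μ j - μ i ≠ 0 := sub_ne_zero.2 fun h => hj (hμ h)
      simpa [D, hj, h4] using this
  have hKd : (fderiv ℂ K 0).comp (.inr ℂ ℂ (Cn n)) = D := by
    have h1 : HasFDerivAt (fun u : Cn n => K (0, u)) ((fderiv ℂ K 0).comp (.inr ℂ ℂ (Cn n))) 0 :=
      HasFDerivAt.comp (0 : Cn n) (f := fun u : Cn n => ((0 : ℂ), u))
        hKa.differentiableAt.hasFDerivAt (hasFDerivAt_prodMk_right 0 0)
    have h2 : HasFDerivAt (fun u : Cn n => K (0, u)) D 0 := by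
      refine HasFDerivAt.congr_of_eventuallyEq ?_ hK0
      rw [hasFDerivAt_pi']
      intro j
      by_cases hj : j = i
      · subst hj
        simp only [if_true]
        refine (hasFDerivAt_coord j 0).congr_fderiv ?_
        ext x
        simp [D]
      · simp only [hj, if_false]
        refine ((((hasFDerivAt_coord i (0 : Cn n)).const_add 1).mul
          (hasFDerivAt_coord j (0 : Cn n))).const_mul (4 * (μ j - μ i))).congr_fderiv ?_
        ext x
        simp [D, hj]
    exact h1.unique h2
  have hinv : ((fderiv ℂ K 0).comp (.inr ℂ ℂ (Cn n))).IsInvertible := by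
    rw [hKd]
    exact ⟨(LinearEquiv.ofInjectiveEndo _ hDinj).toContinuousLinearEquiv, by ext1 x; rfl⟩
  have hcd : ContDiffAt ℂ ⊤ K 0 := hKa.contDiffAt
  have huniq := hcd.eventually_apply_eq_iff_implicitFunction (by simp) hinv
  set ψ := hcd.implicitFunction (by simp) hinv
  have key : ∀ {p : ℂ → Cn n} {σ : ℂ → ℂ} {u : ℂ → Cn n}, IsDiffGerm σ → ContinuousAt u 0 →
      u 0 = 0 → (∀ᶠ s in 𝓝 0, u s i = 0) → (∀ s, p (σ s) = s • (Pi.single i 1 + u s)) →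
      (∀ᶠ t in 𝓝 (0 : ℂ), DiffProportional f g (p t)) →
      ∀ᶠ s in 𝓝 (0 : ℂ), s ≠ 0 → ψ s = u s := by
    intro p σ u hσ hu hu0 hui hpu htan
    have h1 : Tendsto (fun s => (s, u s)) (𝓝 (0 : ℂ)) (𝓝 0) := by
      have : ContinuousAt (fun s => (s, u s)) (0 : ℂ) := continuousAt_id.prodMk hu
      simp only [ContinuousAt, hu0] at this
      exact this
    have h2 : Tendsto (fun s => (u s, s)) (𝓝 (0 : ℂ)) (𝓝 0) := by
      have : ContinuousAt (fun s => (u s, s)) (0 : ℂ) := hu.prodMk continuousAt_id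
      simp only [ContinuousAt, hu0] at this
      exact this
    filter_upwards [h1.eventually huniq, hui, hσ.tendsto.eventually htan,
      eventually_all.2 fun j => h2.eventually (hkfe j),
      eventually_all.2 fun j => h2.eventually (hkge j)] with s e1 e2 e3 e4 e5 hs
    refine e1.1 ?_
    rw [hK00]
    ext j
    by_cases hj : j = i
    · simp [K, hj, e2]
    · simp only [K, hj, if_false, Pi.zero_apply]
      rw [hpu] at e3
      have := e3 (Pi.single i 1) (Pi.single j 1)
      rw [e4, e4, e5, e5] at this
      have h3 : s * s * (kf i (u s, s) * kg j (u s, s) - kf j (u s, s) * kg i (u s, s)) = 0 := by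
        linear_combination this
      exact (mul_eq_zero.1 h3).resolve_left (mul_ne_zero hs hs)
  obtain ⟨τ, σ, u, hτ, hσ, hστ, hu, hu0, hui, hpu⟩ := exists_param_by_coord hp hp0 hc hpd
  obtain ⟨τ', σ', u', hτ', hσ', hστ', hu', hu0', hui', hqu⟩ := exists_param_by_coord hq hq0 hd hqd
  have hPQ : ∀ᶠ s in 𝓝 (0 : ℂ), p (σ s) = q (σ' s) := by
    filter_upwards [key hσ hu hu0 hui hpu hpt, key hσ' hu' hu0' hui' hqu hqt] with s h1 h2
    by_cases hs : s = 0
    · simp [hs, hσ.2.1, hσ'.2.1, hp0, hq0]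
    · rw [hpu, hqu, ← h1 hs, ← h2 hs]
  refine ⟨σ' ∘ τ, hσ'.comp hτ, ?_⟩
  filter_upwards [hστ, hτ.tendsto.eventually hPQ] with t h1 h2
  rw [h1] at h2
  exact h2

end Uniqueness

/-! ### The frame given by numbered tangency curves -/

section Numbering

variable {n : ℕ} {F G : MorseFoliation n} {f g : Cn n → ℂ}

theorem IsTangencyCurve.eventually_diffProportional {C : SmoothCurve n}
    (h : IsTangencyCurve F G C) (hf : F.HasFirstIntegral f) (hg : G.HasFirstIntegral g) :
    ∀ᶠ t in 𝓝 (0 : ℂ), DiffProportional f g (C.param t) := by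
  filter_upwards [h f g hf hg] with t ht
  exact mem_tang_iff.1 ht

/-- The tangents of the tangency curves form a diagonal frame. -/
theorem isDiagonalFrame_of_numbering (hf : F.HasFirstIntegral f) (hg : G.HasFirstIntegral g)
    (hgen : RGeneric f g) {T : Fin n → SmoothCurve n} (hT : NumbersTangencyCurves F G T) :
    IsDiagonalFrame f g fun k => deriv (T k).param 0 := by
  obtain ⟨hfm, hgm, A, μ, hμ, hqf, hqg⟩ := hgen
  obtain ⟨hT1, hT2, -⟩ := hT
  have htan := fun k => (hT1 k).eventually_diffProportional hf hg
  choose σ c hc hσ using fun k => exists_direction hfm hgm hμ hqf hqg (T k).analyticAt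
    (T k).map_zero (T k).regular (htan k)
  have hF := hessian_of_quadPart hfm.analyticAt (μ := fun _ => 1) (by simpa using hqf)
  have hG := hessian_of_quadPart hgm.analyticAt hqg
  simp only [one_mul] at hF
  let B : Cn n ≃L[ℂ] Cn n := A.toContinuousLinearEquiv
  have hB : ∀ x, B x = A x := fun _ => rfl
  have hBd : ∀ x, fderiv ℂ (fun x => B x) x = (B : Cn n →L[ℂ] Cn n) := fun x =>
    B.hasFDerivAt.fderiv
  have hBa : ∀ x, AnalyticAt ℂ (fun x => B x) x := fun x => (B : Cn n →L[ℂ] Cn n).analyticAt x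
  have hHB : ∀ {f : Cn n → ℂ}, IsMorse f → ∀ x y,
      hessian (fun x => f (B x)) x y = hessian f (A x) (A y) := fun hf x y => by
    rw [hessian, fderiv_fderiv_comp hf.analyticAt hf.critical (hBa 0) (by simp), hBd]
    rfl
  have hcB : ∀ {f : Cn n → ℂ}, IsMorse f → fderiv ℂ (fun x => f (B x)) 0 = 0 := fun {f} hf => by
    have := fderiv_comp (g := f) (f := fun x => B x) 0
      (by simpa using hf.analyticAt.differentiableAt) (hBa 0).differentiableAt
    simp only [map_zero, hf.critical, ContinuousLinearMap.zero_comp] at this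
    exact this
  -- Two curves tangent to the same eigendirection are the same germ, by uniqueness in the
  -- coordinates `B`; the numbering then identifies their indices.
  have hinj : Function.Injective σ := by
    intro a b hab
    refine hT2 a b ?_
    have hpa : ∀ k, AnalyticAt ℂ (fun t => B.symm ((T k).param t)) 0 := fun k =>
      ((B.symm : Cn n →L[ℂ] Cn n).analyticAt _).comp (T k).analyticAt
    have hp0 : ∀ k, B.symm ((T k).param 0) = 0 := fun k => by rw [(T k).map_zero, map_zero]
    have hpd : ∀ k, deriv (fun t => B.symm ((T k).param t)) 0 = c k • (Pi.single (σ k) 1 : Cn n) :=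
      fun k => by
        have := ((B.symm : Cn n →L[ℂ] Cn n).hasFDerivAt.comp_hasDerivAt (0 : ℂ)
          (T k).analyticAt.differentiableAt.hasDerivAt).deriv
        refine this.trans ?_
        rw [hσ, map_smul, ← hB]
        simp
    have hpt : ∀ k, ∀ᶠ t in 𝓝 (0 : ℂ), DiffProportional (fun x => f (B x)) (fun x => g (B x))
        (B.symm ((T k).param t)) := fun k => by
      have ht : Tendsto (T k).param (𝓝 0) (𝓝 0) := by
        have := (T k).analyticAt.continuousAt.tendsto
        rwa [(T k).map_zero] at this
      filter_upwards [htan k, ht.eventually hfm.analyticAt.eventually_analyticAt,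
        ht.eventually hgm.analyticAt.eventually_analyticAt] with t h1 h2 h3
      exact DiffProportional.comp (by simpa using h1) (by simpa using h2) (by simpa using h3)
        (hBa _)
    obtain ⟨h, hh, he⟩ := exists_reparam_of_direction
      (f := fun x => f (B x)) (g := fun x => g (B x))
      (hfm.analyticAt.comp_of_eq (hBa 0) (by simp)) (hgm.analyticAt.comp_of_eq (hBa 0) (by simp))
      (hcB hfm) (hcB hgm) hμ (fun x j => by rw [hHB hfm, hF]) (fun x j => by rw [hHB hgm, hG])
      (hpa a) (hpa b) (hp0 a) (hp0 b) (hc a) (hc b) (hpd a) (by rw [hpd b, hab]) (hpt a) (hpt b)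
    exact ⟨h, hh, he.mono fun t ht => B.symm.injective ht⟩
  -- A zero eigenvalue would put an axis in the kernel of the Hessian of `g`.
  have hμ0 : ∀ i, μ i ≠ 0 := fun i hi => by
    have h0 : A (Pi.single i 1) = 0 := hgm.nondegenerate _ fun w => by
      rw [hessian_symm hgm.analyticAt, ← A.apply_symm_apply w, hG, hi]
      simp
    have := congrFun ((map_eq_zero_iff A A.injective).1 h0) i
    simp at this
  have key : IsDiagonalFrame f g fun k => A (Pi.single (σ k) 1) := by
    refine ⟨?_, fun i j hij => ?_, fun i => ?_, fun i => ?_, fun i j hij => ?_⟩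
    · have h1 : LinearIndependent ℂ fun k => (Pi.single (σ k) 1 : Cn n) := by
        have := (Pi.basisFun ℂ (Fin n)).linearIndependent.comp σ hinj
        simpa [Function.comp_def] using this
      exact h1.map' (A : Cn n →ₗ[ℂ] Cn n) A.ker
    · rw [hF]
      simp [hinj.ne hij.symm]
    · rw [hF]; simp
    · rw [hG]; simp [hμ0]
    · rw [hF, hF, hG, hG]
      have := sub_ne_zero.2 (hμ.ne (hinj.ne hij.symm))
      simp only [Pi.single_eq_same, mul_one]
      have h4 : 2 * (2 * μ (σ j)) - 2 * (2 * μ (σ i)) = 4 * (μ (σ j) - μ (σ i)) := by ring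
      rw [h4]
      exact mul_ne_zero (by norm_num) this
  have := key.smul hc
  simpa only [hσ] using this

end Numbering

/-! ### Functions of one variable with a common involution -/

section EvenFunctions

/-- An even analytic germ is an analytic function of the square. -/
theorem exists_eq_comp_sq {e : ℂ → ℂ} (he : AnalyticAt ℂ e 0) (heven : ∀ᶠ z in 𝓝 0, e (-z) = e z) :
    ∃ E : ℂ → ℂ, AnalyticAt ℂ E 0 ∧ ∀ᶠ z in 𝓝 0, e z = E (z ^ 2) := by
  obtain ⟨δ, hδ, hball⟩ := Metric.eventually_nhds_iff_ball.1
    (heven.and he.eventually_analyticAt)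
  have hsq : ∀ w : ℂ, (w ^ (1 / 2 : ℂ)) ^ 2 = w := fun w => by
    rw [← Complex.cpow_nat_mul]; norm_num
  have hsmall : ∀ {r w : ℂ}, r ^ 2 = w → ‖w‖ < δ ^ 2 → r ∈ Metric.ball (0 : ℂ) δ := fun hr hw => by
    rw [mem_ball_zero_iff]
    rw [← hr, norm_pow] at hw
    exact lt_of_pow_lt_pow_left₀ 2 hδ.le hw
  have hroot : ∀ {r w : ℂ}, r ^ 2 = w → ‖w‖ < δ ^ 2 → e (w ^ (1 / 2 : ℂ)) = e r := fun hr hw => by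
    rcases sq_eq_sq_iff_eq_or_eq_neg.1 ((hsq _).trans hr.symm) with h | h
    · rw [h]
    · rw [h, (hball _ (hsmall hr hw)).1]
  have hnear : ∀ᶠ w in 𝓝 (0 : ℂ), ‖w‖ < δ ^ 2 := by
    filter_upwards [Metric.ball_mem_nhds (0 : ℂ) (by positivity : 0 < δ ^ 2)] with w hw
    simpa using hw
  -- Evenness makes the value independent of the square root chosen. Away from `0` some holomorphic
  -- branch `ρ` exists, a rotated one on the cut, and the singularity at `0` is removable by
  -- continuity.
  refine ⟨fun w => e (w ^ (1 / 2 : ℂ)), ?_, ?_⟩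
  · refine Complex.analyticAt_of_differentiable_on_punctured_nhds_of_continuousAt ?_ ?_
    · filter_upwards [hnear.eventually_nhds.filter_mono nhdsWithin_le_nhds, self_mem_nhdsWithin]
        with w hw hw0
      have hw0 : w ≠ 0 := hw0
      obtain ⟨ρ, hρd, hρ⟩ : ∃ ρ : ℂ → ℂ, DifferentiableAt ℂ ρ w ∧ ∀ w, ρ w ^ 2 = w := by
        by_cases hs : w ∈ Complex.slitPlane
        · exact ⟨fun w => w ^ (1 / 2 : ℂ), differentiableAt_id.cpow_const hs, hsq⟩
        · refine ⟨fun w => Complex.I * (-w) ^ (1 / 2 : ℂ), ?_, fun w => ?_⟩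
          · refine (differentiableAt_id.neg.cpow_const ?_).const_mul _
            rw [Complex.mem_slitPlane_iff, not_or, not_lt, not_not] at hs
            refine Complex.mem_slitPlane_iff.2 (Or.inl ?_)
            have h0 : w.re ≠ 0 := fun h => hw0 (Complex.ext h hs.2)
            simpa using lt_of_le_of_ne hs.1 h0
          · rw [mul_pow, hsq, Complex.I_sq]; ring
      have h1 : (fun w => e (w ^ (1 / 2 : ℂ))) =ᶠ[𝓝 w] fun w => e (ρ w) := by
        filter_upwards [hw] with w' hw'
        exact hroot (hρ w') hw'
      refine DifferentiableAt.congr_of_eventuallyEq ?_ h1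
      exact DifferentiableAt.comp w
        (hball _ (hsmall (hρ w) hw.self_of_nhds)).2.differentiableAt hρd
    · have h0 : ContinuousAt (fun w : ℂ => w ^ (1 / 2 : ℂ)) 0 :=
        Complex.continuousAt_cpow_const_of_re_pos (by simp) (by norm_num)
      exact ContinuousAt.comp (f := fun w : ℂ => w ^ (1 / 2 : ℂ))
        (by simpa using he.continuousAt) h0
  · have : Tendsto (fun z : ℂ => z ^ 2) (𝓝 0) (𝓝 0) :=
      (continuous_pow 2).tendsto' _ _ (by simp)
    filter_upwards [this.eventually hnear] with z hz
    exact (hroot rfl hz).symm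

/-- Divide by `t` twice; if the quotient vanished at `0`, so would the second derivative of `F`. -/
theorem exists_eq_sq_mul {F : ℂ → ℂ} (hF : AnalyticAt ℂ F 0) (h0 : F 0 = 0) (h1 : deriv F 0 = 0)
    (h2 : deriv (deriv F) 0 ≠ 0) :
    ∃ a : ℂ → ℂ, AnalyticAt ℂ a 0 ∧ a 0 ≠ 0 ∧ ∀ t, F t = t ^ 2 * a t := by
  have ha := analyticAt_dslope (analyticAt_dslope hF)
  have he : ∀ t, F t = t ^ 2 * dslope (dslope F 0) 0 t := fun t => by
    have e1 := eq_add_mul_dslope F t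
    have e2 := eq_add_mul_dslope (dslope F 0) t
    rw [dslope_same, h1] at e2
    rw [e2, h0] at e1
    rw [e1]; ring
  refine ⟨_, ha, fun ha0 => h2 ?_, he⟩
  set a := dslope (dslope F 0) 0
  have hd : deriv F =ᶠ[𝓝 0] fun t => t * (2 * a t + t * deriv a t) := by
    filter_upwards [ha.eventually_analyticAt] with t ht
    have h3 : HasDerivAt (fun t => t ^ 2 * a t) _ t :=
      (hasDerivAt_pow 2 t).mul ht.differentiableAt.hasDerivAt
    rw [funext he, h3.deriv]
    simp only [Nat.cast_ofNat]
    ring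
  have hg : DifferentiableAt ℂ (fun t => 2 * a t + t * deriv a t) 0 :=
    (ha.differentiableAt.const_mul 2).add (differentiableAt_id.mul ha.deriv.differentiableAt)
  rw [hd.deriv_eq]
  have h4 := ((hasDerivAt_id (0 : ℂ)).mul hg.hasDerivAt).deriv
  refine h4.trans ?_
  simp [ha0]

/-- Dividing by `a 0` first brings the base of the power close to 1, inside the domain of the
principal branch. -/
theorem exists_sqrt {a : ℂ → ℂ} (ha : AnalyticAt ℂ a 0) (ha0 : a 0 ≠ 0) :
    ∃ b : ℂ → ℂ, AnalyticAt ℂ b 0 ∧ b 0 ≠ 0 ∧ ∀ t, b t ^ 2 = a t := by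
  have hsq : ∀ w : ℂ, (w ^ (1 / 2 : ℂ)) ^ 2 = w := fun w => by
    rw [← Complex.cpow_nat_mul]; norm_num
  have hb : ∀ t, (a 0 ^ (1 / 2 : ℂ) * (a t / a 0) ^ (1 / 2 : ℂ)) ^ 2 = a t := fun t => by
    rw [mul_pow, hsq, hsq, mul_div_cancel₀ _ ha0]
  refine ⟨fun t => a 0 ^ (1 / 2 : ℂ) * (a t / a 0) ^ (1 / 2 : ℂ), ?_, fun h => ?_, hb⟩
  · refine analyticAt_const.mul (AnalyticAt.cpow (ha.div analyticAt_const ha0) analyticAt_const ?_)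
    simp [ha0]
  · have := hb 0
    simp only at h
    rw [h] at this
    exact ha0 (by simpa using this.symm)

/-- Two functions of one variable with a nondegenerate critical point and the same involution
differ by a diffeomorphism of the target. -/
theorem exists_diffGerm_comp_eq {F H i : ℂ → ℂ} (hF : AnalyticAt ℂ F 0) (hF0 : F 0 = 0)
    (hF1 : deriv F 0 = 0) (hF2 : deriv (deriv F) 0 ≠ 0) (hH : AnalyticAt ℂ H 0) (hH0 : H 0 = 0)
    (hH1 : deriv H 0 = 0) (hH2 : deriv (deriv H) 0 ≠ 0) (hi : IsDiffGerm i)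
    (hne : ∀ᶠ t in 𝓝[≠] 0, i t ≠ t) (hiF : ∀ᶠ t in 𝓝 0, F (i t) = F t)
    (hiH : ∀ᶠ t in 𝓝 0, H (i t) = H t) :
    ∃ u : ℂ → ℂ, IsDiffGerm u ∧ ∀ᶠ t in 𝓝 0, u (F t) = H t := by
  obtain ⟨a, ha, ha0, hae⟩ := exists_eq_sq_mul hF hF0 hF1 hF2
  obtain ⟨h, hh, hh0, hhe⟩ := exists_eq_sq_mul hH hH0 hH1 hH2
  obtain ⟨b, hb, hb0, hbe⟩ := exists_sqrt ha ha0
  have hFt : Tendsto F (𝓝 0) (𝓝 0) := by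
    have := hF.continuousAt.tendsto; rwa [hF0] at this
  -- A coordinate in which `F` is the square function.
  let s : ℂ → ℂ := fun t => t * b t
  have hs2 : ∀ t, s t ^ 2 = F t := fun t => by rw [hae, ← hbe]; simp only [s]; ring
  have hs : IsDiffGerm s := by
    refine isDiffGerm_iff_deriv.2 ⟨analyticAt_id.mul hb, by simp [s], ?_⟩
    have := ((hasDerivAt_id (0 : ℂ)).mul hb.differentiableAt.hasDerivAt).deriv
    refine fun h => hb0 ?_
    rw [show deriv s 0 = _ from this] at h
    simpa using h
  obtain ⟨σ, hσ, hsσ, hσs⟩ := hs.exists_inverse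
  have hpair : Tendsto (fun t => (i t, t)) (𝓝 (0 : ℂ)) (𝓝 0) :=
    hi.tendsto.prodMk_nhds tendsto_id
  -- Preserving s² leaves only s ↦ s and s ↦ -s, and the involution moves every point other than
  -- `0`. Thus `H` is even in `s`, hence a function of s² = F.
  have hsi : ∀ᶠ t in 𝓝 0, s (i t) = -s t := by
    filter_upwards [hiF, hpair.eventually hs.eventually_injective,
      eventually_nhdsWithin_iff.1 hne] with t h1 h2 h3
    by_cases ht : t = 0
    · simp [ht, hi.2.1, hs.2.1]
    · refine (sq_eq_sq_iff_eq_or_eq_neg.1 ?_).resolve_left fun h => h3 ht (h2 h)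
      rw [hs2, hs2, h1]
  have heven : ∀ᶠ z in 𝓝 0, H (σ (-z)) = H (σ z) := by
    filter_upwards [hsσ, hσ.tendsto.eventually hsi, hσ.tendsto.eventually hiH,
      (hi.tendsto.comp hσ.tendsto).eventually hσs] with z h1 h2 h3 h4
    simp only [Function.comp_apply] at h4
    rw [h2, h1] at h4
    rw [h4, h3]
  obtain ⟨E, hE, hEe⟩ := exists_eq_comp_sq (hH.comp_of_eq hσ.1 hσ.2.1) heven
  have hEF : ∀ᶠ t in 𝓝 0, E (F t) = H t := by
    filter_upwards [hs.tendsto.eventually hEe, hσs] with t h1 h2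
    rw [hs2, Function.comp_apply, h2] at h1
    exact h1.symm
  have hE0 : E 0 = 0 := by
    have := hEF.self_of_nhds
    rwa [hF0, hH0] at this
  refine ⟨E, isDiffGerm_iff_deriv.2 ⟨hE, hE0, fun hE1 => hh0 ?_⟩, hEF⟩
  -- Comparing the coefficients of t² in E(F) = H gives h(0) = a(0) E'(0), so E'(0) cannot vanish.
  have hc : ContinuousAt (fun t => h t - a t * dslope E 0 (F t)) 0 :=
    hh.continuousAt.sub (ha.continuousAt.mul
      ((analyticAt_dslope hE).comp_of_eq hF hF0).continuousAt)
  have := (eventually_eq_zero_of_mul hc (eventually_eq_zero_of_mul (continuousAt_id.mul hc) (by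
    filter_upwards [hEF] with t ht
    rw [eq_add_mul_dslope E, hE0, hhe] at ht
    have h5 := hae t
    change t * (t * (h t - a t * dslope E 0 (F t))) = 0
    linear_combination -ht + dslope E 0 (F t) * h5))).self_of_nhds
  rw [hF0, dslope_same, hE1, mul_zero, sub_zero] at this
  exact this

end EvenFunctions

/-! ### Conjugacy from equal restrictions to the curves -/

section Conjugacy

variable {n : ℕ}

theorem IsMorse.tendsto {f : Cn n → ℂ} (hf : IsMorse f) : Tendsto f (𝓝 0) (𝓝 0) := by
  have := hf.analyticAt.continuousAt.tendsto
  rwa [hf.map_zero] at this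

theorem SmoothCurve.tendsto (C : SmoothCurve n) : Tendsto C.param (𝓝 0) (𝓝 0) := by
  have := C.analyticAt.continuousAt.tendsto
  rwa [C.map_zero] at this

theorem DiffProportional.comp_left {f g : Cn n → ℂ} {a b : ℂ → ℂ} {x : Cn n}
    (h : DiffProportional f g x) (hf : AnalyticAt ℂ f x) (hg : AnalyticAt ℂ g x)
    (ha : AnalyticAt ℂ a (f x)) (hb : AnalyticAt ℂ b (g x)) :
    DiffProportional (fun y => a (f y)) (fun y => b (g y)) x := by
  have key : ∀ {f : Cn n → ℂ} {a : ℂ → ℂ}, AnalyticAt ℂ f x → AnalyticAt ℂ a (f x) → ∀ v,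
      fderiv ℂ (fun y => a (f y)) x v = deriv a (f x) * fderiv ℂ f x v := fun hf ha v => by
    have := (ha.differentiableAt.hasDerivAt.comp_hasFDerivAt x
      hf.differentiableAt.hasFDerivAt).fderiv
    exact congrArg (fun L : Cn n →L[ℂ] ℂ => L v) this
  intro v w
  rw [key hf ha, key hf ha, key hg hb, key hg hb]
  linear_combination deriv a (f x) * deriv b (g x) * h v w

theorem fderiv_comp_left_eq_zero {f : Cn n → ℂ} (hf : IsMorse f) {a : ℂ → ℂ} (ha : IsDiffGerm a) :
    fderiv ℂ (fun x => a (f x)) 0 = 0 := by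
  have h1 : HasDerivAt a (deriv a (f 0)) (f 0) := by
    rw [hf.map_zero]; exact ha.1.differentiableAt.hasDerivAt
  have h2 := (h1.comp_hasFDerivAt (0 : Cn n) hf.analyticAt.differentiableAt.hasFDerivAt).fderiv
  rw [hf.critical] at h2
  exact h2.trans (by ext1 x; simp)

/-- Two pairs of functions whose restrictions to curves in the tangency locus agree, up to
diffeomorphisms of the target, are conjugate. -/
theorem exists_conjugacy {f₀ g₀ f₁ g₁ : Cn n → ℂ} (hf₀ : IsMorse f₀) (hg₀ : IsMorse g₀)
    (hf₁ : IsMorse f₁) (hg₁ : IsMorse g₁) {u v : ℂ → ℂ} (hu : IsDiffGerm u) (hv : IsDiffGerm v)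
    {p₀ p₁ : Fin n → ℂ → Cn n} (hp₀ : ∀ k, AnalyticAt ℂ (p₀ k) 0)
    (hp₁ : ∀ k, AnalyticAt ℂ (p₁ k) 0) (hz₀ : ∀ k, p₀ k 0 = 0) (hz₁ : ∀ k, p₁ k 0 = 0)
    (ht₀ : ∀ k, ∀ᶠ t in 𝓝 (0 : ℂ), DiffProportional f₀ g₀ (p₀ k t))
    (ht₁ : ∀ k, ∀ᶠ t in 𝓝 (0 : ℂ), DiffProportional f₁ g₁ (p₁ k t))
    (hd₀ : IsDiagonalFrame f₀ g₀ fun k => deriv (p₀ k) 0)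
    (hd₁ : IsDiagonalFrame f₁ g₁ fun k => deriv (p₁ k) 0)
    (he : ∀ k, ∀ᶠ t in 𝓝 (0 : ℂ), u (f₀ (p₀ k t)) = f₁ (p₁ k t) ∧ v (g₀ (p₀ k t)) = g₁ (p₁ k t)) :
    ∃ φ : Cn n → Cn n, IsDiffGerm φ ∧ ∀ᶠ x in 𝓝 0, u (f₀ x) = f₁ (φ x) ∧ v (g₀ x) = g₁ (φ x) := by
  have hpt : ∀ k, Tendsto (p₀ k) (𝓝 0) (𝓝 0) := fun k => by
    have := (hp₀ k).continuousAt.tendsto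
    rwa [hz₀ k] at this
  obtain ⟨Φ, hΦ, hΦe⟩ := exists_normalForm (f := fun x => u (f₀ x)) (g := fun x => v (g₀ x))
    (hu.1.comp_of_eq hf₀.analyticAt hf₀.map_zero) (hv.1.comp_of_eq hg₀.analyticAt hg₀.map_zero)
    (by rw [hf₀.map_zero, hu.2.1]) (by rw [hg₀.map_zero, hv.2.1])
    (fderiv_comp_left_eq_zero hf₀ hu) (fderiv_comp_left_eq_zero hg₀ hv) hp₀ hz₀
    (fun k => by
      filter_upwards [ht₀ k, (hpt k).eventually hf₀.analyticAt.eventually_analyticAt,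
        (hpt k).eventually hg₀.analyticAt.eventually_analyticAt,
        (hf₀.tendsto.comp (hpt k)).eventually hu.1.eventually_analyticAt,
        (hg₀.tendsto.comp (hpt k)).eventually hv.1.eventually_analyticAt] with t h1 h2 h3 h4 h5
      exact h1.comp_left h2 h3 h4 h5)
    (hd₀.comp_left hf₀ hg₀ hu hv)
  obtain ⟨Ψ, hΨ, hΨe⟩ := exists_normalForm hf₁.analyticAt hg₁.analyticAt hf₁.map_zero hg₁.map_zero
    hf₁.critical hg₁.critical hp₁ hz₁ ht₁ hd₁
  obtain ⟨Θ, hΘ, hΨΘ, -⟩ := hΨ.exists_inverse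
  have hcoord : ∀ k, Tendsto (fun x => Φ x k) (𝓝 0) (𝓝 0) := fun k =>
    ((continuous_apply k).tendsto' _ _ rfl).comp hΦ.tendsto
  -- `Φ` and `Ψ` bring the two pairs to sums of one-variable functions that `he` identifies, so the
  -- inverse of `Ψ` after `Φ` conjugates them.
  refine ⟨Θ ∘ Φ, hΘ.comp hΦ, ?_⟩
  filter_upwards [hΦe, (hΘ.comp hΦ).tendsto.eventually hΨe, hΦ.tendsto.eventually hΨΘ,
    eventually_all.2 fun k => (hcoord k).eventually (he k)] with x h1 h2 h3 h4
  rw [Function.comp_apply, h3] at h2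
  rw [h1.1, h1.2, Function.comp_apply, h2.1, h2.2]
  exact ⟨Finset.sum_congr rfl fun k _ => (h4 k).1, Finset.sum_congr rfl fun k _ => (h4 k).2⟩

theorem MorseFoliation.HasFirstIntegral.eventually_eq {F : MorseFoliation n} {f : Cn n → ℂ}
    (hf : F.HasFirstIntegral f) {α β : ℂ → Cn n} (hα : Tendsto α (𝓝 0) (𝓝 0))
    (hβ : Tendsto β (𝓝 0) (𝓝 0)) (h : ∀ᶠ t in 𝓝 0, F.sameLeaf (α t) (β t)) :
    ∀ᶠ t in 𝓝 0, f (α t) = f (β t) := by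
  have hαβ : Tendsto (fun t => (α t, β t)) (𝓝 0) (𝓝 0) := hα.prodMk_nhds hβ
  filter_upwards [h, hαβ.eventually hf.2] with t h1 h2
  exact h2.1 h1

/-- A diffeomorphism conjugating first integrals, up to a diffeomorphism of the target, maps leaves
to leaves. -/
theorem MorseFoliation.HasFirstIntegral.eventually_sameLeaf_iff {F₀ F₁ : MorseFoliation n}
    {f₀ f₁ : Cn n → ℂ}
    (hf₀ : F₀.HasFirstIntegral f₀) (hf₁ : F₁.HasFirstIntegral f₁) {u : ℂ → ℂ} (hu : IsDiffGerm u)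
    {φ : Cn n → Cn n} (hφ : IsDiffGerm φ) (h : ∀ᶠ x in 𝓝 0, u (f₀ x) = f₁ (φ x)) :
    ∀ᶠ p : Cn n × Cn n in 𝓝 0, (F₀.sameLeaf p.1 p.2 ↔ F₁.sameLeaf (φ p.1) (φ p.2)) := by
  have hfst : Tendsto (Prod.fst : Cn n × Cn n → Cn n) (𝓝 0) (𝓝 0) := continuous_fst.tendsto' _ _ rfl
  have hsnd : Tendsto (Prod.snd : Cn n × Cn n → Cn n) (𝓝 0) (𝓝 0) := continuous_snd.tendsto' _ _ rfl
  have h1 : Tendsto (fun p : Cn n × Cn n => (φ p.1, φ p.2)) (𝓝 0) (𝓝 0) :=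
    (hφ.tendsto.comp hfst).prodMk_nhds (hφ.tendsto.comp hsnd)
  have h2 : Tendsto (fun p : Cn n × Cn n => (f₀ p.1, f₀ p.2)) (𝓝 0) (𝓝 0) :=
    (hf₀.1.tendsto.comp hfst).prodMk_nhds (hf₀.1.tendsto.comp hsnd)
  filter_upwards [hf₀.2, h1.eventually hf₁.2, h2.eventually hu.eventually_injective,
    hfst.eventually h, hsnd.eventually h] with p e1 e2 e3 e4 e5
  rw [e1, e2, ← e4, ← e5]
  exact ⟨congrArg u, fun h => e3 h⟩

end Conjugacy

/-! ### Reading the restrictions from the invariant -/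

section Reduction

theorem IsDiffGerm.id {E : Type*} [NormedAddCommGroup E] [NormedSpace ℂ E] :
    IsDiffGerm fun x : E => x :=
  ⟨analyticAt_id, rfl, ⟨.refl ℂ E, by rw [fderiv_fun_id]; rfl⟩⟩

/-- The transition maps `φ_{nkn}`, completed by the identity for `k = n`. -/
def InvData.transition {m : ℕ} (I : InvData m) : Fin (m + 1) → ℂ → ℂ :=
  Fin.lastCases (motive := fun _ => ℂ → ℂ) (fun t => t) I.trans

/-- Take `h` to be the holonomy along `F`, so that `f` is carried over unchanged. The holonomy along
`G`, precomposed with the transition map, reaches the same point, hence `g` is carried over up to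
the transition map. -/
theorem IsInvariant.exists_transport {m : ℕ} {F G : MorseFoliation (m + 1)}
    {T : Fin (m + 1) → SmoothCurve (m + 1)} {I : InvData m} (hI : IsInvariant F G T I)
    {f g : Cn (m + 1) → ℂ} (hf : F.HasFirstIntegral f) (hg : G.HasFirstIntegral g)
    (k : Fin (m + 1)) :
    IsDiffGerm (I.transition k) ∧ ∃ h : ℂ → ℂ, IsDiffGerm h ∧ ∀ᶠ t in 𝓝 0,
      f ((T k).param (h t)) = f ((T (Fin.last m)).param t) ∧
      g ((T k).param (h t)) = g ((T (Fin.last m)).param (I.transition k t)) := by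
  refine Fin.lastCases ?_ (fun j => ?_) k
  · simp only [InvData.transition, Fin.lastCases_last]
    exact ⟨.id, _, .id, .of_forall fun t => ⟨rfl, rfl⟩⟩
  · simp only [InvData.transition, Fin.lastCases_castSucc]
    obtain ⟨hF, hG, ⟨hF1, hF2⟩, ⟨hG1, hG2⟩, htr, htre⟩ := hI.2.2 j
    refine ⟨htr, hF, hF1, ?_⟩
    filter_upwards [hf.eventually_eq (SmoothCurve.tendsto _)
        ((SmoothCurve.tendsto _).comp hF1.tendsto) hF2,
      htr.tendsto.eventually (hg.eventually_eq (SmoothCurve.tendsto _)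
        ((SmoothCurve.tendsto _).comp hG1.tendsto) hG2), htre] with t h1 h2 h3
    simp only [Function.comp_apply, h3] at h1 h2
    exact ⟨h1.symm, h2.symm⟩

theorem SmoothCurve.deriv_param_comp {n : ℕ} (C : SmoothCurve n) {h : ℂ → ℂ} (hh : IsDiffGerm h) :
    deriv (fun t => C.param (h t)) 0 = deriv h 0 • deriv C.param 0 := by
  have h1 : HasDerivAt C.param (deriv C.param 0) (h 0) := by
    rw [hh.2.1]; exact C.analyticAt.differentiableAt.hasDerivAt
  exact (h1.scomp (0 : ℂ) hh.1.differentiableAt.hasDerivAt).deriv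

/-- The restrictions of two Morse functions to curves on which their involutions are conjugate
differ by a diffeomorphism of the target. -/
theorem exists_target_diffGerm {n : ℕ} {F₀ F₁ : MorseFoliation n} {f₀ f₁ : Cn n → ℂ}
    (hf₀ : F₀.HasFirstIntegral f₀) (hf₁ : F₁.HasFirstIntegral f₁) {C₀ C₁ : SmoothCurve n}
    (hn₀ : hessian f₀ (deriv C₀.param 0) (deriv C₀.param 0) ≠ 0)
    (hn₁ : hessian f₁ (deriv C₁.param 0) (deriv C₁.param 0) ≠ 0) {i₀ i₁ : ℂ → ℂ}
    (hi₀ : IsLeafInvolution F₀ C₀ i₀) (hi₁ : IsLeafInvolution F₁ C₁ i₁) {ψ : ℂ → ℂ}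
    (hψ : IsDiffGerm ψ) (he : ∀ᶠ t in 𝓝 0, i₁ (ψ t) = ψ (i₀ t)) :
    ∃ u : ℂ → ℂ, IsDiffGerm u ∧ ∀ᶠ t in 𝓝 0, u (f₀ (C₀.param t)) = f₁ (C₁.param (ψ t)) := by
  have hq : AnalyticAt ℂ (fun t => C₁.param (ψ t)) 0 := C₁.analyticAt.comp_of_eq hψ.1 hψ.2.1
  have hq0 : C₁.param (ψ 0) = 0 := by rw [hψ.2.1, C₁.map_zero]
  -- Because `ψ` conjugates the involutions, `i₀` preserves both functions of `t`.
  refine exists_diffGerm_comp_eq (F := fun t => f₀ (C₀.param t))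
    (H := fun t => f₁ (C₁.param (ψ t)))
    (hf₀.1.analyticAt.comp_of_eq C₀.analyticAt C₀.map_zero)
    (by rw [C₀.map_zero, hf₀.1.map_zero])
    (deriv_comp_curve hf₀.1.analyticAt hf₀.1.critical C₀.analyticAt C₀.map_zero)
    (by rwa [deriv_deriv_comp_curve hf₀.1.analyticAt hf₀.1.critical C₀.analyticAt C₀.map_zero])
    (hf₁.1.analyticAt.comp_of_eq hq hq0)
    (by rw [hq0, hf₁.1.map_zero])
    (deriv_comp_curve hf₁.1.analyticAt hf₁.1.critical hq hq0) ?_ hi₀.1 hi₀.2.2 ?_ ?_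
  · rw [deriv_deriv_comp_curve hf₁.1.analyticAt hf₁.1.critical hq hq0, C₁.deriv_param_comp hψ]
    simp only [map_smul, smul_apply, smul_eq_mul]
    have := (isDiffGerm_iff_deriv.1 hψ).2.2
    exact mul_ne_zero this (mul_ne_zero this hn₁)
  · filter_upwards [hf₀.eventually_eq C₀.tendsto
      (C₀.tendsto.comp hi₀.1.tendsto) hi₀.2.1] with t ht
    exact ht.symm
  · filter_upwards [hψ.tendsto.eventually (hf₁.eventually_eq C₁.tendsto
      (C₁.tendsto.comp hi₁.1.tendsto) hi₁.2.1), he] with t h1 h2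
    rw [Function.comp_apply, h2] at h1
    exact h1.symm

theorem InvData.transition_comm {m : ℕ} {I₀ I₁ : InvData m} {ψ : ℂ → ℂ}
    (h : ∀ j, ∀ᶠ t in 𝓝 0, I₁.trans j (ψ t) = ψ (I₀.trans j t)) (k : Fin (m + 1)) :
    ∀ᶠ t in 𝓝 0, I₁.transition k (ψ t) = ψ (I₀.transition k t) := by
  refine Fin.lastCases ?_ (fun j => ?_) k
  · simp [InvData.transition]
  · simpa only [InvData.transition, Fin.lastCases_castSucc] using h j

end Reduction

end MorsePairs

/-! ### Matching the two pairs on all tangency curves -/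

theorem mainTheorem4 (m : ℕ) (F₀ G₀ F₁ G₁ : MorsePairs.MorseFoliation (m + 1))
    (hgen₀ : MorsePairs.FGeneric F₀ G₀) (hgen₁ : MorsePairs.FGeneric F₁ G₁)
    (T₀ T₁ : Fin (m + 1) → MorsePairs.SmoothCurve (m + 1))
    (hT₀ : MorsePairs.NumbersTangencyCurves F₀ G₀ T₀)
    (hT₁ : MorsePairs.NumbersTangencyCurves F₁ G₁ T₁)
    (I₀ I₁ : MorsePairs.InvData m)
    (hI₀ : MorsePairs.IsInvariant F₀ G₀ T₀ I₀) (hI₁ : MorsePairs.IsInvariant F₁ G₁ T₁ I₁)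
    (hI : I₀.Equivalent I₁) :
    MorsePairs.AnalyticallyConjugated F₀ G₀ F₁ G₁ := by
  obtain ⟨f₀, g₀, hf₀, hg₀, hr₀⟩ := hgen₀
  obtain ⟨f₁, g₁, hf₁, hg₁, hr₁⟩ := hgen₁
  obtain ⟨ψ, hψ, hψF, hψG, hψt⟩ := hI
  have hd₀ := MorsePairs.isDiagonalFrame_of_numbering hf₀ hg₀ hr₀ hT₀
  have hd₁ := MorsePairs.isDiagonalFrame_of_numbering hf₁ hg₁ hr₁ hT₁
  obtain ⟨u, hu, hue⟩ := MorsePairs.exists_target_diffGerm hf₀ hf₁ (hd₀.ne _) (hd₁.ne _)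
    hI₀.1 hI₁.1 hψ hψF
  obtain ⟨v, hv, hve⟩ := MorsePairs.exists_target_diffGerm hg₀ hg₁ (hd₀.ne_right _)
    (hd₁.ne_right _) hI₀.2.1 hI₁.2.1 hψ hψG
  choose htr₀ h₀ hh₀ he₀ using hI₀.exists_transport hf₀ hg₀
  choose htr₁ h₁ hh₁ he₁ using hI₁.exists_transport hf₁ hg₁
  have hh₁ψ := fun k => (hh₁ k).comp hψ
  -- All curves of both pairs are parametrized by the parameter of the last curve of the first pair:
  -- through holonomy for the first pair, and through `ψ` followed by holonomy for the second.
  obtain ⟨φ, hφ, hφe⟩ := MorsePairs.exists_conjugacy hf₀.1 hg₀.1 hf₁.1 hg₁.1 hu hv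
    (p₀ := fun k t => (T₀ k).param (h₀ k t)) (p₁ := fun k t => (T₁ k).param (h₁ k (ψ t)))
    (fun k => (T₀ k).analyticAt.comp_of_eq (hh₀ k).1 (hh₀ k).2.1)
    (fun k => (T₁ k).analyticAt.comp_of_eq (hh₁ψ k).1 (hh₁ψ k).2.1)
    (fun k => by rw [(hh₀ k).2.1, (T₀ k).map_zero])
    (fun k => by rw [hψ.2.1, (hh₁ k).2.1, (T₁ k).map_zero])
    (fun k => (hh₀ k).tendsto.eventually ((hT₀.1 k).eventually_diffProportional hf₀ hg₀))
    (fun k => (hh₁ψ k).tendsto.eventually ((hT₁.1 k).eventually_diffProportional hf₁ hg₁))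
    (by
      simp only [fun k => (T₀ k).deriv_param_comp (hh₀ k)]
      exact hd₀.smul fun k => (MorsePairs.isDiffGerm_iff_deriv.1 (hh₀ k)).2.2)
    (by
      have := fun k => (T₁ k).deriv_param_comp (hh₁ψ k)
      simp only [Function.comp_apply] at this
      simp only [this]
      exact hd₁.smul fun k => (MorsePairs.isDiffGerm_iff_deriv.1 (hh₁ψ k)).2.2)
    -- For `f` the identity is the choice of `u` on the last curve. For `g` it is the choice of `v`
    -- at the image under the transition map, which `ψ` intertwines with that of the second pair.
    (fun k => by
      filter_upwards [he₀ k, hψ.tendsto.eventually (he₁ k), hue,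
        (htr₀ k).tendsto.eventually hve, MorsePairs.InvData.transition_comm hψt k]
        with t e1 e2 e3 e4 e5
      rw [e1.1, e1.2, e2.1, e2.2, e3, e4, e5]
      exact ⟨rfl, rfl⟩)
  exact ⟨φ, hφ, hf₀.eventually_sameLeaf_iff hf₁ hu hφ (hφe.mono fun _ h => h.1),
    hg₀.eventually_sameLeaf_iff hg₁ hv hφ (hφe.mono fun _ h => h.2)⟩
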